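/- Let $n\in\mathbb N$, $T>0$ and consider the operator $$\partial_t^3+\sum_{j=0}^{2}\sum_{|\alpha|\le 3-j}a_{j,\alpha}(t)\,\partial_t^j\partial_x^\alpha ,\qquad t\in[0,T],\ x\in\mathbb R^n,$$ whose coefficients are real-analytic functions of $t$ in a neighbourhood of $[0,T]$, real-valued if $j+|\alpha|=3$ and possibly complex-valued if $j+|\alpha|\le 2$. For $\xi\in\mathbb R^n$ put $$L(t,\tau,\xi)=\tau^3+\sum_{j\le 2,\ j+|\alpha|=3}a_{j,\alpha}(t)\tau^j\xi^\alpha,\qquad M(t,\tau,\xi)=\sum_{j+|\alpha|=2}a_{j,\alpha}(t)\tau^j\xi^\alpha,$$ $$\check M(t,\tau,\xi)=M(t,\tau,\xi)-\tfrac12\,\partial_t\partial_\tau L(t,\tau,\xi),\qquad \mathcal L(t,\tau,\xi)=L(t,\tau,\xi)-\partial_\tau^2L(t,\tau,\xi).$$ Assume that for all $(t,\xi)\in[0,T]\times\mathbb R^n$ the polynomial $L(t,\cdot,\xi)$ has only real roots $\tau_1(t,\xi)\le\tau_2(t,\xi)\le\tau_3(t,\xi)$ (weak hyperbolicity), and that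 its discriminant $\Delta_L=(\tau_1-\tau_2)^2(\tau_2-\tau_3)^2(\tau_3-\tau_1)^2$ does not vanish identically on $[0,T]\times\mathbb R^n$. Let $S_3=\{(1,2,3),(2,3,1),(3,1,2)\}$. Suppose that there is a constant $C>0$ such that for all $(j,k,l)\in S_3$ $$|\tau_k(t,\xi)-\tau_l(t,\xi)|\,\bigl|\check M(t,\tau_j(t,\xi),\xi)\bigr|\le C\Bigl(\sqrt{\Delta_L(t,\xi)}+\bigl|\partial_t\sqrt{\Delta_L(t,\xi)}\bigr|\Bigr)$$ at every $(t,\xi)\in[0,T]\times\mathbb R^n$ at which $\sqrt{\Delta_L(\cdot,\xi)}$ is differentiable in $t$ (one-sidedly at $t=0$ and $t=T$). Then for $t\in[0,T]$ and $\xi\neq0$ the roots $\lambda_1(t,\xi)<\lambda_2(t,\xi)<\lambda_3(t,\xi)$ of $\mathcal L(t,\cdot,\xi)$ are real and distinct, and the Levi condition holds: for every $r>0$ there is a constant $C_r>0$ such that, for all $\xi\in\mathbb R^n$ with $|\xi|\ge r$, the integrand below is integrable on $[0,T]$ and $$\int_0^T\sum_{(j,k,l)\in S_3}\frac{\bigl|\check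 M(t,\lambda_j(t,\xi),\xi)\bigr|}{|\lambda_j(t,\xi)-\lambda_k(t,\xi)|\,|\lambda_j(t,\xi)-\lambda_l(t,\xi)|}\,dt\le C_r\log(1+|\xi|).$$ -/

import Mathlib

open Polynomial Set MeasureTheory

noncomputable section

/-- The coefficients of a third order operator
`∂ₜ³ + ∑_{j ≤ 2} ∑_{|α| ≤ 3 - j} a_{j,α}(t) ∂ₜ^j ∂ₓ^α` on `ℝ × ℝⁿ`, depending only on time.
Only the indices with `j ≤ 2` and `j + |α| ≤ 3` matter. The coefficients of the principal part
(`j + |α| = 3`) are real, those of the lower order terms (`j + |α| ≤ 2`) may be complex. -/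
structure ThirdOrderOperator (n : ℕ) where
  /-- `a_{j,α}` for `j + |α| = 3` -/
  top : ℕ → (Fin n → ℕ) → ℝ → ℝ
  /-- `a_{j,α}` for `j + |α| ≤ 2` -/
  low : ℕ → (Fin n → ℕ) → ℝ → ℂ

/-- The set `{(1,2,3), (2,3,1), (3,1,2)}`, with indices shifted to start at `0`. -/
def cyclicTriples : Finset (Fin 3 × Fin 3 × Fin 3) :=
  {(0, 1, 2), (1, 2, 0), (2, 0, 1)}

/-- The `j`-th real root of `P`, the roots being listed in nondecreasing order and repeated
according to multiplicity (used for cubics all of whose roots are real). -/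
def orderedRoot (P : ℝ[X]) (j : Fin 3) : ℝ :=
  (P.roots.sort (· ≤ ·)).getD j 0

namespace ThirdOrderOperator

variable {n : ℕ}

/-- All coefficients are real analytic (in a neighbourhood of each point) on `[0,T]`. -/
def AnalyticCoeffs (P : ThirdOrderOperator n) (T : ℝ) : Prop :=
  (∀ (j : ℕ) (α : Fin n → ℕ), j ≤ 2 → j + ∑ i, α i = 3 →
    AnalyticOnNhd ℝ (P.top j α) (Icc 0 T)) ∧
  (∀ (j : ℕ) (α : Fin n → ℕ), j + ∑ i, α i ≤ 2 →
    AnalyticOnNhd ℝ (P.low j α) (Icc 0 T))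

/-- The principal symbol `L(t,τ,ξ) = τ³ + ∑_{j ≤ 2} ∑_{|α| = 3 - j} a_{j,α}(t) τ^j ξ^α`,
as a polynomial in `τ`. -/
def L (P : ThirdOrderOperator n) (t : ℝ) (ξ : EuclideanSpace ℝ (Fin n)) : ℝ[X] :=
  X ^ 3 + ∑ j ∈ Finset.range 3, ∑ α ∈ Finset.piAntidiag (Finset.univ : Finset (Fin n)) (3 - j),
    C (P.top j α t * ∏ i, ξ i ^ α i) * X ^ j

/-- The second order symbol `M(t,τ,ξ) = ∑_{j + |α| = 2} a_{j,α}(t) τ^j ξ^α`. -/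
def M (P : ThirdOrderOperator n) (t τ : ℝ) (ξ : EuclideanSpace ℝ (Fin n)) : ℂ :=
  ∑ j ∈ Finset.range 3, ∑ α ∈ Finset.piAntidiag (Finset.univ : Finset (Fin n)) (2 - j),
    P.low j α t * ((τ ^ j * ∏ i, ξ i ^ α i : ℝ) : ℂ)

/-- The modified symbol `M(t,τ,ξ) - (1/2) ∂ₜ ∂_τ L(t,τ,ξ)`. -/
def MCheck (P : ThirdOrderOperator n) (t τ : ℝ) (ξ : EuclideanSpace ℝ (Fin n)) : ℂ :=
  P.M t τ ξ - ((1 / 2 * deriv (fun s => (derivative (P.L s ξ)).eval τ) t : ℝ) : ℂ)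

/-- Weak hyperbolicity on `[0,T]`: `L(t,·,ξ)` has only real roots. -/
def WeaklyHyperbolic (P : ThirdOrderOperator n) (T : ℝ) : Prop :=
  ∀ t ∈ Icc 0 T, ∀ ξ : EuclideanSpace ℝ (Fin n), (P.L t ξ).Splits

/-- The roots `τ₁ ≤ τ₂ ≤ τ₃` of `L(t,·,ξ)`. -/
def tau (P : ThirdOrderOperator n) (j : Fin 3) (t : ℝ) (ξ : EuclideanSpace ℝ (Fin n)) : ℝ :=
  orderedRoot (P.L t ξ) j

/-- The discriminant `Δ_L = (τ₁ - τ₂)² (τ₂ - τ₃)² (τ₃ - τ₁)²`. -/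
def discrL (P : ThirdOrderOperator n) (t : ℝ) (ξ : EuclideanSpace ℝ (Fin n)) : ℝ :=
  (P.tau 0 t ξ - P.tau 1 t ξ) ^ 2 * (P.tau 1 t ξ - P.tau 2 t ξ) ^ 2 *
    (P.tau 2 t ξ - P.tau 0 t ξ) ^ 2

/-- The auxiliary polynomial `𝓛 = L - ∂_τ² L`. -/
def calL (P : ThirdOrderOperator n) (t : ℝ) (ξ : EuclideanSpace ℝ (Fin n)) : ℝ[X] :=
  P.L t ξ - derivative (derivative (P.L t ξ))

/-- The roots `λ₁ < λ₂ < λ₃` of `𝓛(t,·,ξ)`. -/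
def lam (P : ThirdOrderOperator n) (j : Fin 3) (t : ℝ) (ξ : EuclideanSpace ℝ (Fin n)) : ℝ :=
  orderedRoot (P.calL t ξ) j

/-- The pointwise condition
`|τ_k - τ_l| |M̌(t,τ_j,ξ)| ≤ C (√Δ_L + |∂ₜ √Δ_L|)` on `[0,T] × ℝⁿ`, for each cyclic triple
`(j,k,l)`. It is required wherever its right-hand side makes sense, that is, at
every `(t,ξ)` such that `√Δ_L(·,ξ)` is differentiable at `t` (one-sidedly at `0` and `T`). -/
def PointwiseBound (P : ThirdOrderOperator n) (T : ℝ) : Prop :=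
  ∃ K : ℝ, 0 < K ∧ ∀ q ∈ cyclicTriples, ∀ t ∈ Icc 0 T, ∀ ξ : EuclideanSpace ℝ (Fin n),
    DifferentiableWithinAt ℝ (fun s => √(P.discrL s ξ)) (Icc 0 T) t →
      |P.tau q.2.1 t ξ - P.tau q.2.2 t ξ| * ‖P.MCheck t (P.tau q.1 t ξ) ξ‖ ≤
        K * (√(P.discrL t ξ) + |derivWithin (fun s => √(P.discrL s ξ)) (Icc 0 T) t|)

/-- The integrand `∑_{(j,k,l)} |M̌(t,λ_j,ξ)| / (|λ_j - λ_k| |λ_j - λ_l|)`. -/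
def leviIntegrand (P : ThirdOrderOperator n) (ξ : EuclideanSpace ℝ (Fin n)) (t : ℝ) : ℝ :=
  ∑ q ∈ cyclicTriples, ‖P.MCheck t (P.lam q.1 t ξ) ξ‖ /
    (|P.lam q.1 t ξ - P.lam q.2.1 t ξ| * |P.lam q.1 t ξ - P.lam q.2.2 t ξ|)

/-- The Levi condition
`∫₀ᵀ ∑_{(j,k,l)} |M̌(t,λ_j,ξ)| / (|λ_j - λ_k| |λ_j - λ_l|) dt ≲ log (1 + |ξ|)`.
The constant is uniform on `{|ξ| ≥ r}`, for each `r > 0`. The first clause (`𝓛(t,·,ξ)` has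
three distinct real roots) and the integrability say that the left-hand side is meaningful. -/
def LeviCondition (P : ThirdOrderOperator n) (T : ℝ) : Prop :=
  (∀ t ∈ Icc 0 T, ∀ ξ : EuclideanSpace ℝ (Fin n), ξ ≠ 0 →
    (P.calL t ξ).Splits ∧ (P.calL t ξ).roots.Nodup) ∧
  ∀ r : ℝ, 0 < r → ∃ K : ℝ, 0 < K ∧ ∀ ξ : EuclideanSpace ℝ (Fin n), r ≤ ‖ξ‖ →
    IntervalIntegrable (P.leviIntegrand ξ) volume 0 T ∧
    ∫ t in (0 : ℝ)..T, P.leviIntegrand ξ t ≤ K * Real.log (1 + ‖ξ‖)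

end ThirdOrderOperator

end

/-!
The Levi integrand `u` is the sum of the absolute values of the Lagrange coefficients of `M̌` at the
nodes `λ_j`, and the pointwise hypothesis bounds the same sum at the nodes `τ_j`. Nuij's
perturbation separates the `λ_j` by at least `1` while moving each root by at most `3`, so
interpolating the quadratic `M̌` at the `τ_j` transfers the bound and gives
`u Δ ≤ K (Δ + |∂ₜΔ|)`, with no singularity left from the coalescing `τ_j`.

It remains to bound `∫ |∂ₜΔ| / Δ` logarithmically and uniformly in `ξ`. The discriminant is
`Δ(t, ξ) = ⟨c(ξ), γ(t)⟩` with `γ` an analytic curve in a finite-dimensional space, and compactness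
of the unit sphere of the span of the jets of `γ` bounds the number of monotone pieces and the
sublevel sets of all these functions at once. With `R` a power of `1 + |ξ|` bounding `u`,
the set where `Δ` is below a power of `R⁻¹` relative to its size is so small that `u ≤ R` suffices
there; elsewhere a change of variables on each monotone piece yields a multiple of `log R`.

The `ξ` with `Δ(·, ξ) ≡ 0` escape this argument. As `Δ` is analytic in `ξ`, they lie in the closure
of the other `ξ`, and the bound extends to them because `∫ u` is continuous in `ξ`.
-/
section Monotonicity

variable {f : ℝ → ℝ} {I : Set ℝ}

theorem differentiableAt_iteratedDeriv {n : WithTop ℕ∞} {m : ℕ} {t : ℝ} (hf : ContDiffAt ℝ n f t)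
    (hm : m < n) : DifferentiableAt ℝ (iteratedDeriv m f) t := by
  rw [iteratedDeriv_eq_equiv_comp, LinearIsometryEquiv.comp_differentiableAt_iff]
  exact hf.differentiableAt_iteratedFDeriv hm

theorem monotoneOn_or_antitoneOn_of_deriv (hI : I.OrdConnected)
    (hf : ∀ t ∈ I, DifferentiableAt ℝ f t)
    (hf' : (∀ t ∈ I, 0 ≤ deriv f t) ∨ ∀ t ∈ I, deriv f t ≤ 0) :
    MonotoneOn f I ∨ AntitoneOn f I := by
  have hcont : ContinuousOn f I := fun t ht => (hf t ht).continuousAt.continuousWithinAt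
  have hdiff : DifferentiableOn ℝ f (interior I) := fun t ht =>
    (hf t (interior_subset ht)).differentiableWithinAt
  exact hf'.imp
    (fun h => monotoneOn_of_deriv_nonneg hI.convex hcont hdiff fun t ht => h t (interior_subset ht))
    (fun h => antitoneOn_of_deriv_nonpos hI.convex hcont hdiff fun t ht => h t (interior_subset ht))

theorem monotoneOn_or_antitoneOn_of_deriv_ne_zero (hI : I.OrdConnected)
    (hf : ∀ t ∈ I, DifferentiableAt ℝ f t) (hf' : ∀ t ∈ I, deriv f t ≠ 0) :
    MonotoneOn f I ∨ AntitoneOn f I :=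
  monotoneOn_or_antitoneOn_of_deriv hI hf <|
    (hasDerivWithinAt_forall_lt_or_forall_gt_of_forall_ne hI.convex
      (fun t ht => (hf t ht).hasDerivAt.hasDerivWithinAt) hf').symm.imp
      (fun h t ht => (h t ht).le) fun h t ht => (h t ht).le

theorem ordConnected_inter_preimage {U : Set ℝ} (hf : MonotoneOn f I ∨ AntitoneOn f I)
    (hI : I.OrdConnected) (hU : U.OrdConnected) : (I ∩ f ⁻¹' U).OrdConnected := by
  obtain ⟨V, hV, heq⟩ : ∃ V : Set ℝ, V.OrdConnected ∧ I ∩ f ⁻¹' U = I ∩ V :=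
    hf.elim hU.preimage_monotoneOn hU.preimage_antitoneOn
  exact heq ▸ hI.inter hV

end Monotonicity

section Sublevel

variable {f : ℝ → ℝ} {I : Set ℝ}

theorem mul_abs_sub_le_abs_sub_of_le_abs_deriv {κ s t : ℝ} (hI : I.OrdConnected)
    (hf : ∀ t ∈ I, DifferentiableAt ℝ f t) (hf' : ∀ t ∈ I, κ ≤ |deriv f t|) (hs : s ∈ I)
    (ht : t ∈ I) : κ * |s - t| ≤ |f s - f t| := by
  wlog hst : t < s generalizing s t
  · rcases (not_lt.mp hst).eq_or_lt with rfl | hst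
    · simp
    · simpa only [abs_sub_comm] using this ht hs hst
  obtain ⟨c, hc, hslope⟩ := exists_deriv_eq_slope f hst
    (fun x hx => (hf x (hI.out ht hs hx)).continuousAt.continuousWithinAt)
    fun x hx => (hf x (hI.out ht hs (Ioo_subset_Icc_self hx))).differentiableWithinAt
  have hκ := hf' c (hI.out ht hs (Ioo_subset_Icc_self hc))
  rwa [hslope, abs_div, le_div_iff₀ (abs_pos.mpr (sub_pos.mpr hst).ne')] at hκ

theorem volume_abs_lt_le_of_le_abs_deriv {κ δ : ℝ} (hκ : 0 < κ) (hI : I.OrdConnected)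
    (hf : ∀ t ∈ I, DifferentiableAt ℝ f t) (hf' : ∀ t ∈ I, κ ≤ |deriv f t|) :
    volume {t ∈ I | |f t| < κ * δ} ≤ ENNReal.ofReal (2 * δ) := by
  refine (Real.volume_le_diam _).trans (Metric.ediam_le_of_forall_dist_le fun s hs t ht => ?_)
  have hmvt := mul_abs_sub_le_abs_sub_of_le_abs_deriv hI hf hf' hs.1 ht.1
  have htri : |f s - f t| ≤ |f s| + |f t| := abs_sub _ _
  refine le_of_mul_le_mul_left ?_ hκ
  rw [Real.dist_eq]
  linarith [hs.2, ht.2]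

theorem volume_abs_lt_le_of_le_abs_iteratedDeriv {m : ℕ} {κ δ : ℝ} (hκ : 0 < κ) (hδ : 0 < δ)
    (hI : I.OrdConnected) (hf : ∀ t ∈ I, ContDiffAt ℝ m f t)
    (hm : ∀ t ∈ I, κ ≤ |iteratedDeriv m f t|) :
    volume {t ∈ I | |f t| < κ * δ ^ m} ≤ ENNReal.ofReal ((2 ^ (m + 1) - 2) * δ) := by
  induction m generalizing κ I with
  | zero =>
    have hempty : {t ∈ I | |f t| < κ * δ ^ 0} = ∅ :=
      eq_empty_of_forall_notMem fun t ht => (hm t ht.1).not_gt (by simpa using ht.2)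
    simp only [hempty, measure_empty, zero_le]
  | succ m ih =>
    set g := iteratedDeriv m f with hg
    have hgdiff : ∀ t ∈ I, DifferentiableAt ℝ g t := fun t ht =>
      differentiableAt_iteratedDeriv (hf t ht) (by exact_mod_cast m.lt_succ_self)
    have hgderiv : ∀ t ∈ I, κ ≤ |deriv g t| := by simpa only [hg, ← iteratedDeriv_succ] using hm
    have hgmono : MonotoneOn g I ∨ AntitoneOn g I := monotoneOn_or_antitoneOn_of_deriv_ne_zero hI
      hgdiff fun t ht => abs_pos.mp (hκ.trans_le (hgderiv t ht))
    have hfar : ∀ U : Set ℝ, U.OrdConnected → (∀ y ∈ U, κ * δ ≤ |y|) →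
        volume {t ∈ I ∩ g ⁻¹' U | |f t| < κ * δ * δ ^ m} ≤
          ENNReal.ofReal ((2 ^ (m + 1) - 2) * δ) := fun U hU hUκ =>
      ih (by positivity) (ordConnected_inter_preimage hgmono hI hU)
        (fun t ht => (hf t ht.1).of_le (by exact_mod_cast m.le_succ)) fun t ht => hUκ _ ht.2
    have hcover : {t ∈ I | |f t| < κ * δ ^ (m + 1)} ⊆ {t ∈ I | |g t| < κ * δ} ∪
        ({t ∈ I ∩ g ⁻¹' Ici (κ * δ) | |f t| < κ * δ * δ ^ m} ∪
          {t ∈ I ∩ g ⁻¹' Iic (-(κ * δ)) | |f t| < κ * δ * δ ^ m}) := by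
      rintro t ⟨htI, htf⟩
      rw [pow_succ', ← mul_assoc] at htf
      rcases lt_or_ge |g t| (κ * δ) with hlt | hge
      · exact .inl ⟨htI, hlt⟩
      · rcases le_abs'.mp hge with hneg | hpos
        · exact .inr (.inr ⟨⟨htI, hneg⟩, htf⟩)
        · exact .inr (.inl ⟨⟨htI, hpos⟩, htf⟩)
    have hC : (0 : ℝ) ≤ (2 ^ (m + 1) - 2) * δ :=
      mul_nonneg (sub_nonneg.mpr (le_self_pow₀ one_le_two m.succ_ne_zero)) hδ.le
    refine (measure_mono hcover).trans <| (measure_union_le _ _).trans <| (add_le_add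
      (volume_abs_lt_le_of_le_abs_deriv hκ hI hgdiff hgderiv) <| (measure_union_le _ _).trans <|
      add_le_add (hfar _ ordConnected_Ici fun y hy => hy.trans (le_abs_self y))
        (hfar _ ordConnected_Iic fun y hy => le_abs'.mpr (.inl hy))).trans ?_
    rw [← ENNReal.ofReal_add hC hC, ← ENNReal.ofReal_add (by positivity) (by positivity)]
    exact ENNReal.ofReal_le_ofReal (by ring_nf; rfl)

end Sublevel

section ChangeOfVariables

variable {f : ℝ → ℝ} {I : Set ℝ}

theorem lintegral_abs_deriv_mul_le_of_monotoneOn_or_antitoneOn (w : ℝ → ENNReal)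
    (hI : I.OrdConnected) (hf : ∀ t ∈ I, DifferentiableAt ℝ f t)
    (hmono : MonotoneOn f I ∨ AntitoneOn f I) :
    ∫⁻ t in I, ENNReal.ofReal |deriv f t| * w (f t) ≤ ∫⁻ y in f '' I, w y := by
  rcases I.subsingleton_or_nontrivial with hsub | hnt
  · exact (setLIntegral_measure_zero I _ (hsub.measure_zero volume)).trans_le zero_le
  have hderiv : ∀ t ∈ I, HasDerivWithinAt f (deriv f t) I t := fun t ht =>
    (hf t ht).hasDerivAt.hasDerivWithinAt
  have hunique : UniqueDiffOn ℝ I :=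
    uniqueDiffOn_convex hI.convex (hI.convex.nontrivial_iff_nonempty_interior.mp hnt)
  have hwithin : ∀ t ∈ I, derivWithin f I t = deriv f t := fun t ht =>
    (hderiv t ht).derivWithin (hunique t ht)
  rcases hmono with hmono | hanti
  · rw [lintegral_image_eq_lintegral_deriv_mul_of_monotoneOn hI.measurableSet hderiv hmono]
    refine (setLIntegral_congr_fun hI.measurableSet fun t ht => ?_).le
    simp only [← hwithin t ht, abs_of_nonneg hmono.derivWithin_nonneg]
  · rw [lintegral_image_eq_lintegral_deriv_mul_of_antitoneOn hI.measurableSet hderiv hanti]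
    refine (setLIntegral_congr_fun hI.measurableSet fun t ht => ?_).le
    simp only [← hwithin t ht, abs_of_nonpos hanti.derivWithin_nonpos]

theorem lintegral_abs_deriv_mul_le {k : ℕ} (w : ℝ → ENNReal) (hI : I.OrdConnected)
    (hf : ∀ t ∈ I, ContDiffAt ℝ (k + 1 : ℕ) f t)
    (hmono : MonotoneOn (iteratedDeriv k f) I ∨ AntitoneOn (iteratedDeriv k f) I) :
    ∫⁻ t in I, ENNReal.ofReal |deriv f t| * w (f t) ≤ 2 ^ k * ∫⁻ y in f '' I, w y := by
  induction k generalizing I with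
  | zero =>
    rw [iteratedDeriv_zero] at hmono
    simpa only [pow_zero, one_mul] using lintegral_abs_deriv_mul_le_of_monotoneOn_or_antitoneOn w hI
      (fun t ht => (hf t ht).differentiableAt (by norm_num)) hmono
  | succ k ih =>
    have hdiff : ∀ t ∈ I, DifferentiableAt ℝ (iteratedDeriv k f) t := fun t ht =>
      differentiableAt_iteratedDeriv (hf t ht) (by exact_mod_cast (by lia : k < k + 1 + 1))
    set g := iteratedDeriv (k + 1) f
    have hpiece : ∀ U : Set ℝ, U.OrdConnected → ((∀ y ∈ U, 0 ≤ y) ∨ ∀ y ∈ U, y ≤ 0) →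
        ∫⁻ t in I ∩ g ⁻¹' U, ENNReal.ofReal |deriv f t| * w (f t) ≤
          2 ^ k * ∫⁻ y in f '' I, w y := by
      intro U hU hsign
      have hJ := ordConnected_inter_preimage hmono hI hU
      have hJmono := monotoneOn_or_antitoneOn_of_deriv hJ (fun t ht => hdiff t ht.1) <| by
        rw [← iteratedDeriv_succ]
        exact hsign.imp (fun h t ht => h _ ht.2) fun h t ht => h _ ht.2
      refine (ih hJ (fun t ht => (hf t ht.1).of_le (by norm_cast; lia)) hJmono).trans ?_
      gcongr
      exact inter_subset_left
    have hcover : I = I ∩ g ⁻¹' Ici 0 ∪ I ∩ g ⁻¹' Iic 0 := by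
      rw [← inter_union_distrib_left, ← preimage_union, Ici_union_Iic, preimage_univ, inter_univ]
    calc ∫⁻ t in I, ENNReal.ofReal |deriv f t| * w (f t)
        ≤ (∫⁻ t in I ∩ g ⁻¹' Ici 0, ENNReal.ofReal |deriv f t| * w (f t)) +
          ∫⁻ t in I ∩ g ⁻¹' Iic 0, ENNReal.ofReal |deriv f t| * w (f t) := by
          conv_lhs => rw [hcover]
          exact lintegral_union_le _ _ _
      _ ≤ 2 ^ k * (∫⁻ y in f '' I, w y) + 2 ^ k * ∫⁻ y in f '' I, w y :=
        add_le_add (hpiece _ ordConnected_Ici (.inl fun y hy => hy))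
          (hpiece _ ordConnected_Iic (.inr fun y hy => hy))
      _ = 2 ^ (k + 1) * ∫⁻ y in f '' I, w y := by ring

end ChangeOfVariables

section LogDerivBound

/-- The functions `u ≤ R` on `I` dominated by the modulus of the logarithmic derivative of `f ≥ 0`,
in the sense that `u * f ≤ f + |f'|` (so that nothing is required of `f` where `u ≤ 1`), have
integral at most `K * log R` over `S`, with the same `K` for all `R ≥ 2`. -/
def HasLogDerivBound (f : ℝ → ℝ) (I S : Set ℝ) (K : NNReal) : Prop :=
  ∀ (R : ℝ) (u : ℝ → ℝ), 2 ≤ R →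
    (∀ t ∈ I, 0 ≤ f t ∧ u t ≤ R ∧ u t * f t ≤ f t + |deriv f t|) →
    ∫⁻ t in S, ENNReal.ofReal (u t) ≤ K * ENNReal.ofReal (Real.log R)

namespace HasLogDerivBound

variable {f g : ℝ → ℝ} {I J S S' : Set ℝ} {K K' : NNReal}

theorem mono (h : HasLogDerivBound f I S K) (hI : I ⊆ J) (hS : S' ⊆ S) (hK : K ≤ K') :
    HasLogDerivBound f J S' K' := fun R u hR hu =>
  calc ∫⁻ t in S', ENNReal.ofReal (u t) ≤ ∫⁻ t in S, ENNReal.ofReal (u t) := lintegral_mono_set hS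
    _ ≤ K * ENNReal.ofReal (Real.log R) := h R u hR fun t ht => hu t (hI ht)
    _ ≤ K' * ENNReal.ofReal (Real.log R) := by gcongr

theorem union (h : HasLogDerivBound f I S K) (h' : HasLogDerivBound f I S' K') :
    HasLogDerivBound f I (S ∪ S') (K + K') := fun R u hR hu =>
  calc ∫⁻ t in S ∪ S', ENNReal.ofReal (u t)
      ≤ (∫⁻ t in S, ENNReal.ofReal (u t)) + ∫⁻ t in S', ENNReal.ofReal (u t) :=
        lintegral_union_le _ _ _
    _ ≤ K * ENNReal.ofReal (Real.log R) + K' * ENNReal.ofReal (Real.log R) :=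
        add_le_add (h R u hR hu) (h' R u hR hu)
    _ = (K + K' : NNReal) * ENNReal.ofReal (Real.log R) := by rw [ENNReal.coe_add, add_mul]

theorem of_eq_const_mul {r : ℝ} (hr : 0 < r) (hf : ∀ t ∈ I, f t = r * g t)
    (hf' : ∀ t ∈ I, deriv f t = r * deriv g t) (h : HasLogDerivBound g I S K) :
    HasLogDerivBound f I S K := by
  intro R u hR hu
  refine h R u hR fun t ht => ?_
  obtain ⟨hf0, huR, huf⟩ := hu t ht
  rw [hf t ht] at hf0 huf
  rw [hf' t ht, abs_mul, abs_of_pos hr, mul_left_comm, ← mul_add] at huf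
  exact ⟨nonneg_of_mul_nonneg_right hf0 hr, huR, le_of_mul_le_mul_left huf hr⟩

theorem lintegral_le_of_mul_le (h : HasLogDerivBound f I S K) {A R : ℝ} {u : ℝ → ℝ} (hA : 0 < A)
    (hR : 2 ≤ R)
    (hu : ∀ t ∈ I, 0 ≤ f t ∧ u t ≤ A * R ∧ u t * f t ≤ A * (f t + |deriv f t|)) :
    ∫⁻ t in S, ENNReal.ofReal (u t) ≤ ENNReal.ofReal (A * (K * Real.log R)) :=
  calc ∫⁻ t in S, ENNReal.ofReal (u t)
      = ENNReal.ofReal A * ∫⁻ t in S, ENNReal.ofReal (u t / A) := by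
        rw [← lintegral_const_mul' _ _ ENNReal.ofReal_ne_top]
        refine lintegral_congr fun t => ?_
        rw [← ENNReal.ofReal_mul hA.le, mul_div_cancel₀ _ hA.ne']
    _ ≤ ENNReal.ofReal A * (K * ENNReal.ofReal (Real.log R)) := by
        refine mul_le_mul_right (h R _ hR fun t ht => ⟨(hu t ht).1, ?_, ?_⟩) _
        · exact (div_le_iff₀' hA).2 (hu t ht).2.1
        · rw [div_mul_eq_mul_div]
          exact (div_le_iff₀' hA).2 (hu t ht).2.2
    _ = ENNReal.ofReal (A * (K * Real.log R)) := by
        rw [ENNReal.ofReal_mul hA.le, ENNReal.ofReal_mul K.coe_nonneg, ENNReal.ofReal_coe_nnreal]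

theorem of_lintegral_le_add {a b : NNReal}
    (h : ∀ (R : ℝ) (u : ℝ → ℝ), 2 ≤ R →
      (∀ t ∈ I, 0 ≤ f t ∧ u t ≤ R ∧ u t * f t ≤ f t + |deriv f t|) →
      ∫⁻ t in S, ENNReal.ofReal (u t) ≤ a + b * ENNReal.ofReal (Real.log R)) :
    HasLogDerivBound f I S (2 * a + b) := by
  intro R u hR hu
  have hlog : 1 ≤ 2 * ENNReal.ofReal (Real.log R) := by
    rw [← ENNReal.ofReal_ofNat, ← ENNReal.ofReal_mul zero_le_two, ENNReal.one_le_ofReal]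
    linarith [Real.log_two_gt_d9, Real.log_le_log two_pos hR]
  calc ∫⁻ t in S, ENNReal.ofReal (u t)
      ≤ a * 1 + b * ENNReal.ofReal (Real.log R) := by rw [mul_one]; exact h R u hR hu
    _ ≤ a * (2 * ENNReal.ofReal (Real.log R)) + b * ENNReal.ofReal (Real.log R) := by gcongr
    _ = (2 * a + b : NNReal) * ENNReal.ofReal (Real.log R) := by push_cast; ring

end HasLogDerivBound

variable {f u : ℝ → ℝ} {I : Set ℝ} {κ S : ℝ}

theorem measurableSet_inter_preimage_of_continuousOn {U : Set ℝ} (hI : MeasurableSet I)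
    (hf : ContinuousOn f I) (hU : MeasurableSet U) : MeasurableSet (I ∩ f ⁻¹' U) := by
  have hpre := hI.subtype_image (hf.domRestrict.measurable hU)
  rwa [domRestrict_eq, preimage_comp, Subtype.image_preimage_coe] at hpre

theorem setLIntegral_le_of_le_abs_iteratedDeriv {m : ℕ} {R : ℝ} (hκ : 0 < κ) (hR : 0 < R)
    (hI : I.OrdConnected) (hf : ∀ t ∈ I, ContDiffAt ℝ m f t)
    (hm : ∀ t ∈ I, κ ≤ |iteratedDeriv m f t|) (hu : ∀ t ∈ I, u t ≤ R) :
    ∫⁻ t in {t ∈ I | |f t| < κ * R⁻¹ ^ m}, ENNReal.ofReal (u t) ≤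
      ENNReal.ofReal (2 ^ (m + 1) - 2) := by
  set A := {t ∈ I | |f t| < κ * R⁻¹ ^ m}
  have hA : MeasurableSet A := measurableSet_inter_preimage_of_continuousOn hI.measurableSet
    (fun t ht => (hf t ht).continuousAt.continuousWithinAt)
    (measurableSet_lt measurable_id.abs measurable_const)
  calc ∫⁻ t in A, ENNReal.ofReal (u t)
      ≤ ∫⁻ _ in A, ENNReal.ofReal R :=
        setLIntegral_mono' hA fun t ht => ENNReal.ofReal_le_ofReal (hu t ht.1)
    _ = ENNReal.ofReal R * volume A := setLIntegral_const _ _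
    _ ≤ ENNReal.ofReal R * ENNReal.ofReal ((2 ^ (m + 1) - 2) * R⁻¹) := by
      gcongr
      exact volume_abs_lt_le_of_le_abs_iteratedDeriv hκ (inv_pos.mpr hR) hI hf hm
    _ = ENNReal.ofReal (2 ^ (m + 1) - 2) := by
      rw [← ENNReal.ofReal_mul hR.le, mul_left_comm, mul_inv_cancel₀ hR.ne', mul_one]

theorem setLIntegral_Icc_inv_le {ε : ℝ} (hε : 0 < ε) :
    ∫⁻ y in Icc ε S, ENNReal.ofReal y⁻¹ ≤ ENNReal.ofReal (Real.log (S / ε)) := by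
  rcases lt_or_ge S ε with hlt | hle
  · simp only [Icc_eq_empty hlt.not_ge, Measure.restrict_empty, lintegral_zero_measure, zero_le]
  have hcont : ContinuousOn (fun y : ℝ => y⁻¹) (Icc ε S) :=
    continuousOn_inv₀.mono fun y hy => (hε.trans_le hy.1).ne'
  rw [← integral_inv_of_pos hε (hε.trans_le hle), intervalIntegral.integral_of_le hle,
    ← integral_Icc_eq_integral_Ioc, ofReal_integral_eq_lintegral_ofReal hcont.integrableOn_Icc]
  exact (ae_restrict_iff' measurableSet_Icc).mpr <| .of_forall fun y hy =>
    inv_nonneg.mpr (hε.le.trans hy.1)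

theorem setLIntegral_le_of_mul_le_add_abs_deriv {k : ℕ} {ε : ℝ} (hε : 0 < ε) (hI : I.OrdConnected)
    (hf : ∀ t ∈ I, ContDiffAt ℝ (k + 1 : ℕ) f t)
    (hmono : MonotoneOn (iteratedDeriv k f) I ∨ AntitoneOn (iteratedDeriv k f) I)
    (hfS : ∀ t ∈ I, f t ≤ S) (hu : ∀ t ∈ I, u t * f t ≤ f t + |deriv f t|) :
    ∫⁻ t in I ∩ f ⁻¹' Ici ε, ENNReal.ofReal (u t) ≤
      volume I + 2 ^ k * ENNReal.ofReal (Real.log (S / ε)) := by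
  set w : ℝ → ENNReal := (Icc ε S).indicator fun y => ENNReal.ofReal y⁻¹ with hw
  have hcont : ContinuousOn f I := fun t ht => (hf t ht).continuousAt.continuousWithinAt
  have huw : ∀ t ∈ I ∩ f ⁻¹' Ici ε,
      ENNReal.ofReal (u t) ≤ 1 + ENNReal.ofReal |deriv f t| * w (f t) := by
    rintro t ⟨htI, htε⟩
    have hft : 0 < f t := hε.trans_le htε
    rw [hw, indicator_of_mem (mem_Icc.mpr ⟨htε, hfS t htI⟩), ← ENNReal.ofReal_one,
      ← ENNReal.ofReal_mul (abs_nonneg _), ← ENNReal.ofReal_add zero_le_one (by positivity)]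
    refine ENNReal.ofReal_le_ofReal ((le_div_iff₀ hft).mpr (hu t htI) |>.trans_eq ?_)
    rw [add_div, div_self hft.ne', div_eq_mul_inv]
  calc ∫⁻ t in I ∩ f ⁻¹' Ici ε, ENNReal.ofReal (u t)
      ≤ ∫⁻ t in I ∩ f ⁻¹' Ici ε, (1 + ENNReal.ofReal |deriv f t| * w (f t)) := setLIntegral_mono'
        (measurableSet_inter_preimage_of_continuousOn hI.measurableSet hcont measurableSet_Ici) huw
    _ ≤ ∫⁻ t in I, (1 + ENNReal.ofReal |deriv f t| * w (f t)) :=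
      lintegral_mono_set inter_subset_left
    _ = volume I + ∫⁻ t in I, ENNReal.ofReal |deriv f t| * w (f t) := by
      rw [lintegral_add_left measurable_const, setLIntegral_one]
    _ ≤ volume I + 2 ^ k * ∫⁻ y, w y := by
      gcongr
      exact (lintegral_abs_deriv_mul_le w hI hf hmono).trans
        (mul_le_mul_right (setLIntegral_le_lintegral _ _) _)
    _ ≤ volume I + 2 ^ k * ENNReal.ofReal (Real.log (S / ε)) := by
      rw [hw, lintegral_indicator measurableSet_Icc]
      gcongr
      exact setLIntegral_Icc_inv_le hε

theorem hasLogDerivBound_of_le_abs {ℓ : NNReal} (hκ : 0 < κ) (hI : MeasurableSet I)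
    (hℓ : volume I ≤ ℓ) (hf : ∀ t ∈ I, κ ≤ |f t|) (hf' : ∀ t ∈ I, |deriv f t| ≤ S) :
    HasLogDerivBound f I I (2 * ((1 + S / κ).toNNReal * ℓ)) := by
  rw [← add_zero (2 * _)]
  refine .of_lintegral_le_add fun R u _ hu => ?_
  have huS : ∀ t ∈ I, u t ≤ 1 + S / κ := fun t ht => by
    obtain ⟨hf0, -, huf⟩ := hu t ht
    have hκf : κ ≤ f t := abs_of_nonneg hf0 ▸ hf t ht
    have hft : 0 < f t := hκ.trans_le hκf
    refine ((le_div_iff₀ hft).mpr huf).trans ?_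
    rw [add_div, div_self hft.ne']
    gcongr
    · exact (abs_nonneg _).trans (hf' t ht)
    · exact hf' t ht
  calc ∫⁻ t in I, ENNReal.ofReal (u t)
      ≤ ∫⁻ _ in I, ENNReal.ofReal (1 + S / κ) :=
        setLIntegral_mono' hI fun t ht => ENNReal.ofReal_le_ofReal (huS t ht)
    _ = ENNReal.ofReal (1 + S / κ) * volume I := setLIntegral_const _ _
    _ ≤ _ := by
      push_cast
      rw [zero_mul, add_zero]
      exact mul_le_mul_right hℓ _

theorem hasLogDerivBound_of_le_abs_iteratedDeriv_succ {k : ℕ} {ℓ : NNReal} (hκ : 0 < κ)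
    (hI : I.OrdConnected) (hℓ : volume I ≤ ℓ) (hf : ∀ t ∈ I, ContDiffAt ℝ (k + 1 : ℕ) f t)
    (hk : ∀ t ∈ I, κ ≤ |iteratedDeriv (k + 1) f t|) (hS : 0 < S) (hfS : ∀ t ∈ I, f t ≤ S) :
    HasLogDerivBound f I I (2 * ((2 ^ (k + 2) - 2 : ℝ).toNNReal + (ℓ + 2 ^ k *
      (Real.log (S / κ)).toNNReal)) + 2 ^ k * (k + 1 : ℕ)) := by
  refine .of_lintegral_le_add fun R u hR hu => ?_
  have hR0 : 0 < R := two_pos.trans_le hR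
  set ε := κ * R⁻¹ ^ (k + 1) with hε
  have hmono := monotoneOn_or_antitoneOn_of_deriv_ne_zero hI
    (fun t ht => differentiableAt_iteratedDeriv (hf t ht) (by exact_mod_cast k.lt_succ_self))
    fun t ht => abs_pos.mp <| hκ.trans_le <| by simpa only [iteratedDeriv_succ] using hk t ht
  have hcover : I ⊆ {t ∈ I | |f t| < ε} ∪ I ∩ f ⁻¹' Ici ε := fun t ht =>
    (lt_or_ge (f t) ε).imp (fun h => ⟨ht, (abs_of_nonneg (hu t ht).1).trans_lt h⟩) fun h => ⟨ht, h⟩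
  have hsmall := setLIntegral_le_of_le_abs_iteratedDeriv hκ hR0 hI hf hk fun t ht => (hu t ht).2.1
  have hlarge := setLIntegral_le_of_mul_le_add_abs_deriv (by positivity : 0 < ε) hI hf hmono hfS
    fun t ht => (hu t ht).2.2
  have hlog : ENNReal.ofReal (Real.log (S / ε)) ≤ ENNReal.ofReal (Real.log (S / κ)) +
      (k + 1 : ℕ) * ENNReal.ofReal (Real.log R) := by
    rw [← ENNReal.ofReal_natCast, ← ENNReal.ofReal_mul (Nat.cast_nonneg _)]
    refine le_trans (ENNReal.ofReal_le_ofReal (Eq.le ?_)) ENNReal.ofReal_add_le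
    rw [← Real.log_pow, ← Real.log_mul (by positivity) (by positivity), hε, inv_pow, ← div_div,
      div_inv_eq_mul]
  calc ∫⁻ t in I, ENNReal.ofReal (u t)
      ≤ ∫⁻ t in {t ∈ I | |f t| < ε} ∪ I ∩ f ⁻¹' Ici ε, ENNReal.ofReal (u t) :=
        lintegral_mono_set hcover
    _ ≤ _ := (lintegral_union_le _ _ _).trans (add_le_add hsmall hlarge)
    _ ≤ ENNReal.ofReal (2 ^ (k + 2) - 2) + (ℓ + 2 ^ k * (ENNReal.ofReal (Real.log (S / κ)) +
          (k + 1 : ℕ) * ENNReal.ofReal (Real.log R))) := by gcongr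
    _ = _ := by
      simp only [ENNReal.ofReal]
      push_cast
      ring

theorem exists_hasLogDerivBound_of_le_abs_iteratedDeriv (m : ℕ) (ℓ : NNReal) (hκ : 0 < κ)
    (hS : 0 < S) :
    ∃ K, ∀ f I, I.OrdConnected → volume I ≤ ℓ → (∀ t ∈ I, ContDiffAt ℝ m f t) →
      (∀ t ∈ I, κ ≤ |iteratedDeriv m f t|) → (∀ t ∈ I, f t ≤ S ∧ |deriv f t| ≤ S) →
      HasLogDerivBound f I I K := by
  cases m with
  | zero => exact ⟨_, fun f I hI hℓ _ hm hfS =>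
      hasLogDerivBound_of_le_abs hκ hI.measurableSet hℓ
        (by simpa only [iteratedDeriv_zero] using hm) fun t ht => (hfS t ht).2⟩
  | succ k => exact ⟨_, fun f I hI hℓ hf hm hfS =>
      hasLogDerivBound_of_le_abs_iteratedDeriv_succ hκ hI hℓ hf hm hS fun t ht => (hfS t ht).1⟩

end LogDerivBound

section Curves

open Filter Topology

theorem iteratedDeriv_eq_zero_of_forall_eq_zero {F : Type*} [NormedAddCommGroup F]
    [NormedSpace ℝ F] [CompleteSpace F] {f : ℝ → F} {I : Set ℝ} {s t : ℝ} (hI : IsPreconnected I)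
    (hf : AnalyticOnNhd ℝ f I) (hs : s ∈ I) (h : ∀ k, iteratedDeriv k f s = 0) (ht : t ∈ I)
    (k : ℕ) : iteratedDeriv k f t = 0 := by
  have hf₀ : f =ᶠ[𝓝 s] fun _ => 0 := analyticOrderAt_eq_top.1 <| ENat.eq_top_iff_forall_ge.2
    fun m => (natCast_le_analyticOrderAt_iff_iteratedDeriv_eq_zero (hf s hs)).2 fun i _ => h i
  have hfk : AnalyticOnNhd ℝ (iteratedDeriv k f) I := by
    rw [iteratedDeriv_eq_iterate]
    exact hf.iterated_deriv k
  refine hfk.eqOn_zero_of_preconnected_of_eventuallyEq_zero hI hs ?_ ht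
  filter_upwards [hf₀.eventuallyEq_nhds] with x hx
  rw [hx.iteratedDeriv_eq, iteratedDeriv_fun_const_zero, Pi.zero_apply]

variable {E : Type*} [NormedAddCommGroup E] [InnerProductSpace ℝ E] {γ : ℝ → E} {I : Set ℝ}

theorem iteratedDeriv_inner_const {t : ℝ} {k : ℕ} (hγ : ContDiffAt ℝ k γ t) (c : E) :
    iteratedDeriv k (fun s => inner ℝ c (γ s)) t = inner ℝ c (iteratedDeriv k γ t) := by
  rw [iteratedDeriv_eq_iteratedFDeriv, iteratedDeriv_eq_iteratedFDeriv]
  exact congrArg (fun A => A fun _ => 1) ((innerSL ℝ c).iteratedFDeriv_comp_left hγ le_rfl)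

theorem inner_iteratedDeriv_eq_zero_of_forall_eq_zero [CompleteSpace E] (hI : IsPreconnected I)
    (hγ : AnalyticOnNhd ℝ γ I) {c : E} {s t : ℝ} (hs : s ∈ I)
    (h : ∀ k, inner ℝ c (iteratedDeriv k γ s) = 0) (ht : t ∈ I) (k : ℕ) :
    inner ℝ c (iteratedDeriv k γ t) = 0 := by
  rw [← iteratedDeriv_inner_const (hγ t ht).contDiffAt]
  refine iteratedDeriv_eq_zero_of_forall_eq_zero hI
    ((innerSL ℝ c).comp_analyticOnNhd hγ) hs (fun i => ?_) ht k
  exact (iteratedDeriv_inner_const (hγ s hs).contDiffAt c).trans (h i)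

theorem continuousAt_inner_iteratedDeriv [CompleteSpace E] {t : ℝ} (hγ : AnalyticAt ℝ γ t) (c : E)
    (k : ℕ) : ContinuousAt (fun p : E × ℝ => inner ℝ p.1 (iteratedDeriv k γ p.2)) (c, t) := by
  rw [iteratedDeriv_eq_iterate]
  exact continuousAt_fst.inner ((hγ.iterated_deriv k).continuousAt.comp continuousAt_snd)

theorem exists_hasLogDerivBound_inner_nhds [CompleteSpace E] (hI : I.OrdConnected)
    (hI' : volume I ≠ ⊤) (hγ : AnalyticOnNhd ℝ γ I) {c : E} {t : ℝ} (ht : t ∈ I) {m : ℕ}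
    (hm : inner ℝ c (iteratedDeriv m γ t) ≠ 0) :
    ∃ K, ∃ J ∈ 𝓝 t, ∀ᶠ c' in 𝓝 c,
      HasLogDerivBound (fun s => inner ℝ c' (γ s)) I (I ∩ J) K := by
  let g (k : ℕ) (p : E × ℝ) : ℝ := inner ℝ p.1 (iteratedDeriv k γ p.2)
  have hg (k : ℕ) : ContinuousAt (g k) (c, t) := continuousAt_inner_iteratedDeriv (hγ t ht) c k
  set S := max |g 0 (c, t)| |g 1 (c, t)| + 1
  have hS0 : |g 0 (c, t)| < S := (le_max_left _ _).trans_lt (lt_add_one _)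
  have hS1 : |g 1 (c, t)| < S := (le_max_right _ _).trans_lt (lt_add_one _)
  have hev : ∀ᶠ p in 𝓝 c ×ˢ 𝓝 t, |g m (c, t)| / 2 < |g m p| ∧ g 0 p < S ∧ |g 1 p| < S := by
    rw [← nhds_prod_eq]
    exact ((hg m).abs.eventually_const_lt (half_lt_self (abs_pos.2 hm))).and
      (((hg 0).eventually_lt_const (lt_of_abs_lt hS0)).and ((hg 1).abs.eventually_lt_const hS1))
  obtain ⟨pc, hpc, pt, hpt, hp⟩ := eventually_prod_iff.1 hev
  obtain ⟨δ, hδ, hball⟩ := Metric.eventually_nhds_iff_ball.1 hpt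
  obtain ⟨K, hK⟩ := exists_hasLogDerivBound_of_le_abs_iteratedDeriv m (volume I).toNNReal
    (half_pos (abs_pos.2 hm)) ((abs_nonneg _).trans_lt hS0)
  refine ⟨K, Metric.ball t δ, Metric.ball_mem_nhds t hδ, hpc.mono fun c' hc' => ?_⟩
  have hder (k : ℕ) {s : ℝ} (hs : s ∈ I) :
      iteratedDeriv k (fun s => inner ℝ c' (γ s)) s = g k (c', s) :=
    iteratedDeriv_inner_const (hγ s hs).contDiffAt c'
  refine (hK _ (I ∩ Metric.ball t δ) (hI.inter (convex_ball t δ).ordConnected) ?_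
    (fun s hs => ?_) (fun s hs => ?_) fun s hs => ?_).mono inter_subset_left le_rfl le_rfl
  · rw [ENNReal.coe_toNNReal hI']
    exact measure_mono inter_subset_left
  · exact contDiffAt_const.inner ℝ (hγ s hs.1).contDiffAt
  · rw [hder m hs.1]
    exact (hp hc' (hball s hs.2)).1.le
  · have hs' := (hp hc' (hball s hs.2)).2
    rw [← hder 0 hs.1, ← hder 1 hs.1, iteratedDeriv_zero, iteratedDeriv_one] at hs'
    exact hs'.imp le_of_lt le_of_lt

theorem exists_eventually_hasLogDerivBound_inner [CompleteSpace E] (hI : I.OrdConnected)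
    (hI' : IsCompact I) (hγ : AnalyticOnNhd ℝ γ I) {c : E} {t₀ : ℝ} (ht₀ : t₀ ∈ I) {m : ℕ}
    (hm : inner ℝ c (iteratedDeriv m γ t₀) ≠ 0) :
    ∃ K, ∀ᶠ c' in 𝓝 c, HasLogDerivBound (fun s => inner ℝ c' (γ s)) I I K := by
  refine hI'.induction_on (p := fun S => ∃ K, ∀ᶠ c' in 𝓝 c,
    HasLogDerivBound (fun s => inner ℝ c' (γ s)) I S K) ?_ ?_ ?_ ?_
  · exact ⟨0, Eventually.of_forall fun c' R u _ _ => by simp⟩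
  · rintro S S' hS ⟨K, hK⟩
    exact ⟨K, hK.mono fun c' hc' => hc'.mono subset_rfl hS le_rfl⟩
  · rintro S S' ⟨K, hK⟩ ⟨K', hK'⟩
    exact ⟨K + K', hK.and hK' |>.mono fun c' hc' => hc'.1.union hc'.2⟩
  · intro t ht
    obtain ⟨k, hk⟩ : ∃ k, inner ℝ c (iteratedDeriv k γ t) ≠ 0 := by
      by_contra! h
      exact hm (inner_iteratedDeriv_eq_zero_of_forall_eq_zero hI.isPreconnected hγ ht h ht₀ m)
    obtain ⟨K, J, hJ, hK⟩ := exists_hasLogDerivBound_inner_nhds hI hI'.measure_ne_top hγ ht hk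
    exact ⟨I ∩ J, inter_mem self_mem_nhdsWithin (mem_nhdsWithin_of_mem_nhds hJ), K, hK⟩

/-- The span of the derivatives of all orders of `γ` at `t`. For an analytic curve, its orthogonal
complement consists of the linear forms that vanish along the curve. -/
def jetSpan (γ : ℝ → E) (t : ℝ) : Submodule ℝ E :=
  Submodule.span ℝ (range fun k => iteratedDeriv k γ t)

theorem mem_orthogonal_jetSpan_iff {c : E} {t : ℝ} :
    c ∈ (jetSpan γ t)ᗮ ↔ ∀ k, inner ℝ c (iteratedDeriv k γ t) = 0 := by
  refine ⟨fun hc k => (Submodule.mem_orthogonal' _ _).1 hc _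
    (Submodule.subset_span (mem_range_self k)), fun h => (Submodule.mem_orthogonal' _ _).2 ?_⟩
  have hle : jetSpan γ t ≤ (ℝ ∙ c)ᗮ := Submodule.span_le.2 <| range_subset_iff.2 fun k =>
    Submodule.mem_orthogonal_singleton_iff_inner_right.2 (h k)
  exact fun v hv => Submodule.mem_orthogonal_singleton_iff_inner_right.1 (hle hv)

variable [FiniteDimensional ℝ E]

theorem exists_forall_hasLogDerivBound_inner_of_mem_jetSpan (hI : I.OrdConnected)
    (hI' : IsCompact I) (hγ : AnalyticOnNhd ℝ γ I) {t : ℝ} (ht : t ∈ I) :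
    ∃ K, ∀ c ∈ jetSpan γ t, ‖c‖ = 1 → HasLogDerivBound (fun s => inner ℝ c (γ s)) I I K := by
  have : CompleteSpace E := FiniteDimensional.complete ℝ E
  have hZ : IsCompact (Metric.sphere (0 : E) 1 ∩ jetSpan γ t) :=
    haveI := FiniteDimensional.proper_real E
    (isCompact_sphere 0 1).inter_right (jetSpan γ t).closed_of_finiteDimensional
  suffices h : ∃ K, ∀ c ∈ Metric.sphere (0 : E) 1 ∩ jetSpan γ t,
      HasLogDerivBound (fun s => inner ℝ c (γ s)) I I K by
    obtain ⟨K, hK⟩ := h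
    exact ⟨K, fun c hc hc1 => hK c ⟨mem_sphere_zero_iff_norm.2 hc1, hc⟩⟩
  refine hZ.induction_on (p := fun S => ∃ K, ∀ c ∈ S,
    HasLogDerivBound (fun s => inner ℝ c (γ s)) I I K) ⟨0, by simp⟩ ?_ ?_ ?_
  · rintro S S' hS ⟨K, hK⟩
    exact ⟨K, fun c hc => hK c (hS hc)⟩
  · rintro S S' ⟨K, hK⟩ ⟨K', hK'⟩
    refine ⟨max K K', ?_⟩
    rintro c (hc | hc)
    · exact (hK c hc).mono subset_rfl subset_rfl (le_max_left K K')
    · exact (hK' c hc).mono subset_rfl subset_rfl (le_max_right K K')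
  · rintro c ⟨hc1, hc⟩
    obtain ⟨m, hm⟩ : ∃ m, inner ℝ c (iteratedDeriv m γ t) ≠ 0 := by
      by_contra! h
      have hc0 : c = 0 := (Submodule.disjoint_def.1 (jetSpan γ t).orthogonal_disjoint) c hc
        (mem_orthogonal_jetSpan_iff.2 h)
      exact one_ne_zero (α := ℝ) (by simpa [hc0] using mem_sphere_zero_iff_norm.1 hc1)
    obtain ⟨K, hK⟩ := exists_eventually_hasLogDerivBound_inner hI hI' hγ ht hm
    exact ⟨_, mem_nhdsWithin_of_mem_nhds hK, K, fun c hc => hc⟩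

theorem exists_forall_hasLogDerivBound_inner (hI : I.OrdConnected) (hI' : IsCompact I)
    (hγ : AnalyticOnNhd ℝ γ I) :
    ∃ K, ∀ c, (∃ t ∈ I, inner ℝ c (γ t) ≠ 0) →
      HasLogDerivBound (fun t => inner ℝ c (γ t)) I I K := by
  have : CompleteSpace E := FiniteDimensional.complete ℝ E
  obtain rfl | ⟨t₀, ht₀⟩ := I.eq_empty_or_nonempty
  · exact ⟨0, by simp⟩
  obtain ⟨K, hK⟩ := exists_forall_hasLogDerivBound_inner_of_mem_jetSpan hI hI' hγ ht₀
  refine ⟨K, fun c ⟨t₁, ht₁, hc⟩ => ?_⟩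
  obtain ⟨v, hv, w, hw, rfl⟩ := (jetSpan γ t₀).exists_add_mem_mem_orthogonal c
  have hw' {t : ℝ} (ht : t ∈ I) (k : ℕ) : inner ℝ w (iteratedDeriv k γ t) = 0 :=
    inner_iteratedDeriv_eq_zero_of_forall_eq_zero hI.isPreconnected hγ ht₀
      (mem_orthogonal_jetSpan_iff.1 hw) ht k
  have hv0 : v ≠ 0 := by
    rintro rfl
    rw [zero_add] at hc
    exact hc (by simpa using hw' ht₁ 0)
  have hscale {t : ℝ} (ht : t ∈ I) (k : ℕ) :
      iteratedDeriv k (fun s => inner ℝ (v + w) (γ s)) t =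
        ‖v‖ * iteratedDeriv k (fun s => inner ℝ (‖v‖⁻¹ • v) (γ s)) t := by
    rw [iteratedDeriv_inner_const (hγ t ht).contDiffAt,
      iteratedDeriv_inner_const (hγ t ht).contDiffAt, inner_add_left, hw' ht, add_zero,
      real_inner_smul_left, mul_inv_cancel_left₀ (norm_ne_zero_iff.2 hv0)]
  refine (hK (‖v‖⁻¹ • v) (Submodule.smul_mem _ _ hv) (norm_smul_inv_norm hv0)).of_eq_const_mul
    (norm_pos_iff.2 hv0) (fun t ht => by simpa only [iteratedDeriv_zero] using hscale ht 0)
    fun t ht => by simpa only [iteratedDeriv_one] using hscale ht 1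

end Curves

section OrderedRoot

theorem orderedRoot_eq_getElem {P : ℝ[X]} (hP : P.roots.card = 3) (j : Fin 3) :
    orderedRoot P j = (P.roots.sort (· ≤ ·))[j]'(by simp [hP]) :=
  List.getD_eq_getElem _ _ _

theorem monotone_orderedRoot {P : ℝ[X]} (hP : P.roots.card = 3) : Monotone (orderedRoot P) := by
  intro i j hij
  rw [orderedRoot_eq_getElem hP, orderedRoot_eq_getElem hP]
  exact (Multiset.pairwise_sort P.roots (· ≤ ·)).sortedLE.getElem_le_getElem_of_le hij

theorem roots_eq_orderedRoot {P : ℝ[X]} (hP : P.roots.card = 3) :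
    P.roots = {orderedRoot P 0, orderedRoot P 1, orderedRoot P 2} := by
  obtain ⟨a, b, c, habc⟩ :=
    List.length_eq_three.1 ((Multiset.length_sort (· ≤ ·) (s := P.roots)).trans hP)
  rw [← Multiset.sort_eq P.roots (· ≤ ·)]
  simp only [orderedRoot, habc]
  rfl

end OrderedRoot

theorem norm_le_of_cubic_eq_zero {𝕜 : Type*} [NormedField 𝕜] {a b c x : 𝕜}
    (h : x ^ 3 + a * x ^ 2 + b * x + c = 0) : ‖x‖ ≤ 1 + ‖a‖ + ‖b‖ + ‖c‖ := by
  by_contra! hlt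
  have hx : 1 ≤ ‖x‖ := by linarith [norm_nonneg a, norm_nonneg b, norm_nonneg c]
  have hcube : ‖x‖ ^ 3 ≤ ‖a‖ * ‖x‖ ^ 2 + ‖b‖ * ‖x‖ + ‖c‖ := by
    rw [← norm_pow, (by linear_combination h : x ^ 3 = -(a * x ^ 2 + b * x + c)), norm_neg]
    refine (norm_add₃_le).trans_eq ?_
    rw [norm_mul, norm_mul, norm_pow]
  have hb : ‖b‖ * ‖x‖ ≤ ‖b‖ * ‖x‖ ^ 2 := by gcongr; exact le_self_pow₀ hx two_ne_zero
  have hc : ‖c‖ ≤ ‖c‖ * ‖x‖ ^ 2 := le_mul_of_one_le_right (norm_nonneg c) (one_le_pow₀ hx)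
  nlinarith [pow_pos (one_pos.trans_le hx) 2]

section RealCubic

variable {P : Cubic ℝ}

theorem cubic_roots_eq_orderedRoot (ha : P.a ≠ 0) (hP : P.toPoly.Splits) :
    P.roots = {orderedRoot P.toPoly 0, orderedRoot P.toPoly 1, orderedRoot P.toPoly 2} := by
  have h3 := (Cubic.splits_iff_card_roots (φ := RingHom.id ℝ) ha).1 (by rwa [map_id])
  exact roots_eq_orderedRoot h3

theorem eval_toPoly_eq_prod_orderedRoot (ha : P.a ≠ 0) (hP : P.toPoly.Splits) (u : ℝ) :
    P.toPoly.eval u = P.a * ∏ j, (u - orderedRoot P.toPoly j) := by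
  have hprod := Cubic.eq_prod_three_roots (φ := RingHom.id ℝ) ha (cubic_roots_eq_orderedRoot ha hP)
  have heval := congrArg (Polynomial.eval u) hprod
  simp only [eval_mul, eval_sub, eval_C, eval_X, RingHom.id_apply] at heval
  rw [Fin.prod_univ_three, ← mul_assoc, ← mul_assoc]
  exact heval

theorem exists_isRoot_toPoly (ha : P.a ≠ 0) : ∃ r, P.toPoly.IsRoot r := by
  by_contra! h
  have hdeg := Cubic.natDegree_of_a_ne_zero ha
  have := (irreducible_of_degree_le_three_of_not_isRoot (by simp [hdeg]) h).natDegree_le_two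
  lia

theorem splits_of_discr_pos (ha : P.a ≠ 0) (hP : 0 < P.discr) : P.toPoly.Splits := by
  obtain ⟨r, hr⟩ := exists_isRoot_toPoly ha
  obtain ⟨a, b, c, d⟩ := P
  have hd : d = -(a * r ^ 3 + b * r ^ 2 + c * r) := by
    simp only [IsRoot.def, Cubic.toPoly, eval_add, eval_mul, eval_C, eval_pow, eval_X] at hr
    linear_combination hr
  have hdiscr : Cubic.discr ⟨a, b, c, d⟩ =
      ((b + a * r) ^ 2 - 4 * a * (c + r * (b + a * r))) * (3 * a * r ^ 2 + 2 * b * r + c) ^ 2 := by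
    rw [hd, Cubic.discr]
    ring
  have hq : 0 ≤ (b + a * r) ^ 2 - 4 * a * (c + r * (b + a * r)) :=
    (pos_of_mul_pos_left (hdiscr ▸ hP) (sq_nonneg _)).le
  set s := √((b + a * r) ^ 2 - 4 * a * (c + r * (b + a * r)))
  have hs2 : s ^ 2 = (b + a * r) ^ 2 - 4 * a * (c + r * (b + a * r)) := Real.sq_sqrt hq
  have hprod : (⟨a, b, c, d⟩ : Cubic ℝ).toPoly = C a * (X - C r) *
      (X - C ((-(b + a * r) + s) / (2 * a))) * (X - C ((-(b + a * r) - s) / (2 * a))) := by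
    rw [Cubic.C_mul_prod_X_sub_C_eq, Cubic.toPoly_injective]
    congr 1
    · field
    · field_simp
      linear_combination hs2
    · rw [hd]
      field_simp
      linear_combination -r * hs2
  rw [hprod]
  exact (((Splits.C a).mul (Splits.X_sub_C _)).mul (Splits.X_sub_C _)).mul (Splits.X_sub_C _)

theorem sq_discr_roots_eq {x y z : ℝ} (ha : P.a ≠ 0) (hP : P.roots = {x, y, z}) :
    P.discr = (P.a * P.a * (x - y) * (x - z) * (y - z)) ^ 2 :=
  Cubic.discr_eq_prod_three_roots (φ := RingHom.id ℝ) ha hP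

theorem discr_nonneg_of_splits (ha : P.a ≠ 0) (hP : P.toPoly.Splits) : 0 ≤ P.discr := by
  rw [sq_discr_roots_eq ha (cubic_roots_eq_orderedRoot ha hP)]
  positivity

theorem three_mul_le_sq_of_discr_nonneg (hP : 0 ≤ P.discr) : 3 * (P.a * P.c) ≤ P.b ^ 2 := by
  have h : 4 * (P.b ^ 2 - 3 * (P.a * P.c)) ^ 3 = 27 * P.a ^ 2 * P.discr +
      (2 * P.b ^ 3 - 9 * P.a * P.b * P.c + 27 * P.a ^ 2 * P.d) ^ 2 := by
    rw [Cubic.discr]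
    ring
  have h3 : 0 ≤ (P.b ^ 2 - 3 * (P.a * P.c)) ^ 3 := by
    have : 0 ≤ 4 * (P.b ^ 2 - 3 * (P.a * P.c)) ^ 3 := by rw [h]; positivity
    linarith
  exact sub_nonneg.1 ((Odd.pow_nonneg_iff (by decide)).1 h3)

end RealCubic

section Nuij

/-- The cubic `P - P''`, Nuij's perturbation of `P`: if the roots of `P` are real, then those of
`P - P''` are real and separated. -/
def nuijCubic {R : Type*} [CommRing R] (P : Cubic R) : Cubic R :=
  ⟨P.a, P.b, P.c - 6 * P.a, P.d - 2 * P.b⟩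

theorem toPoly_nuijCubic {R : Type*} [CommRing R] (P : Cubic R) :
    (nuijCubic P).toPoly = P.toPoly - derivative (derivative P.toPoly) := by
  have derivative_X_pow_two : derivative (X ^ 2 : R[X]) = 2 * X := by
    rw [derivative_X_pow, Nat.cast_ofNat, map_ofNat, pow_one]
  have derivative_X_pow_three : derivative (X ^ 3 : R[X]) = 3 * X ^ 2 := by
    rw [derivative_X_pow, Nat.cast_ofNat, map_ofNat]
  simp only [Cubic.toPoly, nuijCubic, derivative_add, derivative_mul, derivative_C,
    derivative_X_pow_two, derivative_X_pow_three, derivative_X, derivative_ofNat, C_sub, C_mul,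
    map_ofNat, map_zero, derivative_one]
  ring

theorem discr_nuijCubic {R : Type*} [CommRing R] (P : Cubic R) :
    (nuijCubic P).discr = P.discr + 8 * ((P.b ^ 2 - 3 * (P.a * P.c)) ^ 2 +
      18 * P.a ^ 2 * (P.b ^ 2 - 3 * (P.a * P.c)) + 108 * P.a ^ 4) := by
  simp only [Cubic.discr, nuijCubic]
  ring

theorem discr_nuijCubic_pos {P : Cubic ℝ} (ha : P.a ≠ 0) (hP : 0 ≤ P.discr) :
    0 < (nuijCubic P).discr := by
  have hh := sub_nonneg.2 (three_mul_le_sq_of_discr_nonneg hP)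
  rw [discr_nuijCubic]
  positivity

theorem splits_nuijCubic {P : Cubic ℝ} (ha : P.a ≠ 0) (hP : P.toPoly.Splits) :
    (nuijCubic P).toPoly.Splits :=
  splits_of_discr_pos ha (discr_nuijCubic_pos ha (discr_nonneg_of_splits ha hP))

theorem nodup_roots_nuijCubic {P : Cubic ℝ} (ha : P.a ≠ 0) (hP : P.toPoly.Splits) :
    (nuijCubic P).toPoly.roots.Nodup :=
  (Cubic.discr_ne_zero_iff_roots_nodup (φ := RingHom.id ℝ) (P := nuijCubic P) ha
    (by rw [Polynomial.map_id]; exact splits_nuijCubic ha hP)).1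
    (discr_nuijCubic_pos ha (discr_nonneg_of_splits ha hP)).ne'

/-- `τ` and `x` list in nondecreasing order the roots of a real cubic `P` and of `P - P''`, as
expressed by their elementary symmetric functions. -/
structure IsNuijPair (τ x : Fin 3 → ℝ) : Prop where
  monotone_left : Monotone τ
  monotone_right : Monotone x
  e₁ : x 0 + x 1 + x 2 = τ 0 + τ 1 + τ 2
  e₂ : x 0 * x 1 + x 0 * x 2 + x 1 * x 2 = τ 0 * τ 1 + τ 0 * τ 2 + τ 1 * τ 2 - 6
  e₃ : x 0 * x 1 * x 2 = τ 0 * τ 1 * τ 2 - 2 * (τ 0 + τ 1 + τ 2)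

theorem isNuijPair_orderedRoot {P : Cubic ℝ} (ha : P.a ≠ 0) (hP : P.toPoly.Splits) :
    IsNuijPair (orderedRoot P.toPoly) (orderedRoot (nuijCubic P).toPoly) := by
  have hτ := cubic_roots_eq_orderedRoot ha hP
  have hx := cubic_roots_eq_orderedRoot (P := nuijCubic P) ha (splits_nuijCubic ha hP)
  have hb := Cubic.b_eq_three_roots (φ := RingHom.id ℝ) ha hτ
  have hc := Cubic.c_eq_three_roots (φ := RingHom.id ℝ) ha hτ
  have hd := Cubic.d_eq_three_roots (φ := RingHom.id ℝ) ha hτ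
  have hb' := Cubic.b_eq_three_roots (φ := RingHom.id ℝ) (P := nuijCubic P) ha hx
  have hc' := Cubic.c_eq_three_roots (φ := RingHom.id ℝ) (P := nuijCubic P) ha hx
  have hd' := Cubic.d_eq_three_roots (φ := RingHom.id ℝ) (P := nuijCubic P) ha hx
  refine ⟨monotone_orderedRoot (congrArg Multiset.card hτ),
    monotone_orderedRoot (congrArg Multiset.card hx), ?_, ?_, ?_⟩
  all_goals
    generalize orderedRoot (nuijCubic P).toPoly = x at *
    simp only [nuijCubic, RingHom.id_apply] at hb hc hd hb' hc' hd'
    refine mul_left_cancel₀ ha ?_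
  · linear_combination hb' - hb
  · linear_combination hc - hc'
  · linear_combination hd' - hd + 2 * hb

namespace IsNuijPair

variable {τ x : Fin 3 → ℝ}

theorem prod_sub_eq (h : IsNuijPair τ x) (u : ℝ) : (u - x 0) * (u - x 1) * (u - x 2) =
    (u - τ 0) * (u - τ 1) * (u - τ 2) - 2 * (3 * u - (τ 0 + τ 1 + τ 2)) := by
  linear_combination -u ^ 2 * h.e₁ + u * h.e₂ - h.e₃

theorem neg_comp_rev (h : IsNuijPair τ x) : IsNuijPair (-τ ∘ Fin.rev) (-x ∘ Fin.rev) where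
  monotone_left := (h.monotone_left.comp_antitone Fin.rev_anti).neg
  monotone_right := (h.monotone_right.comp_antitone Fin.rev_anti).neg
  e₁ := by
    change -x 2 + -x 1 + -x 0 = -τ 2 + -τ 1 + -τ 0
    linear_combination -h.e₁
  e₂ := by
    change -x 2 * -x 1 + -x 2 * -x 0 + -x 1 * -x 0 =
      -τ 2 * -τ 1 + -τ 2 * -τ 0 + -τ 1 * -τ 0 - 6
    linear_combination h.e₂
  e₃ := by
    change -x 2 * -x 1 * -x 0 = -τ 2 * -τ 1 * -τ 0 - 2 * (-τ 2 + -τ 1 + -τ 0)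
    linear_combination -h.e₃

theorem left_two_le (h : IsNuijPair τ x) : τ 2 ≤ x 2 := by
  by_contra! hlt
  have h0 : τ 0 ≤ τ 2 := h.monotone_left (by decide)
  have h1 : τ 1 ≤ τ 2 := h.monotone_left (by decide)
  have hx0 : x 0 < τ 2 := (h.monotone_right (by decide)).trans_lt hlt
  have hx1 : x 1 < τ 2 := (h.monotone_right (by decide)).trans_lt hlt
  have hpos := mul_pos (mul_pos (sub_pos.2 hx0) (sub_pos.2 hx1)) (sub_pos.2 hlt)
  have heval := h.prod_sub_eq (τ 2)
  rw [sub_self, mul_zero] at heval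
  linarith

theorem right_two_le (h : IsNuijPair τ x) : x 2 ≤ τ 2 + 3 := by
  by_contra! hlt
  have h0 : τ 0 ≤ τ 2 := h.monotone_left (by decide)
  have h1 : τ 1 ≤ τ 2 := h.monotone_left (by decide)
  have hp : 0 < x 2 - τ 0 - 3 := by linarith
  have hq : 0 < x 2 - τ 1 - 3 := by linarith
  have hr : 0 < x 2 - τ 2 - 3 := by linarith
  have heval := h.prod_sub_eq (x 2)
  rw [sub_self, mul_zero] at heval
  linarith [mul_pos hp hq, mul_pos hp hr, mul_pos hq hr, mul_pos (mul_pos hp hq) hr]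

theorem abs_sub_le (h : IsNuijPair τ x) (j : Fin 3) : |x j - τ j| ≤ 3 := by
  have h₁ := h.left_two_le
  have h₂ := h.right_two_le
  have h₃ : -τ 0 ≤ -x 0 := h.neg_comp_rev.left_two_le
  have h₄ : -x 0 ≤ -τ 0 + 3 := h.neg_comp_rev.right_two_le
  have he := h.e₁
  rw [abs_le]
  fin_cases j <;> constructor <;> dsimp <;> linarith

theorem one_le_one_sub_zero (h : IsNuijPair τ x) : 1 ≤ x 1 - x 0 := by
  have discr_eq (a b c : ℝ) : ((b - a) * ((c - b) * (c - a))) ^ 2 =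
      (a + b + c) ^ 2 * (a * b + a * c + b * c) ^ 2 - 4 * (a * b + a * c + b * c) ^ 3 -
        4 * (a + b + c) ^ 3 * (a * b * c) +
        18 * (a + b + c) * (a * b + a * c + b * c) * (a * b * c) - 27 * (a * b * c) ^ 2 := by
    ring
  have sq_sum_eq (a b c : ℝ) : (b - a) ^ 2 + (c - b) * (c - a) =
      (a + b + c) ^ 2 - 3 * (a * b + a * c + b * c) := by
    ring
  have h01 : 0 ≤ x 1 - x 0 := sub_nonneg.2 (h.monotone_right (by decide))
  have h12 : 0 ≤ x 2 - x 1 := sub_nonneg.2 (h.monotone_right (by decide))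
  set q := (τ 1 - τ 0) ^ 2 + (τ 2 - τ 1) * (τ 2 - τ 0) with hq
  have hq0 : 0 ≤ q := by
    have := h.monotone_left (show (0 : Fin 3) ≤ 1 by decide)
    have := h.monotone_left (show (1 : Fin 3) ≤ 2 by decide)
    exact add_nonneg (sq_nonneg _) (mul_nonneg (by linarith) (by linarith))
  have hxq : (x 1 - x 0) ^ 2 + (x 2 - x 1) * (x 2 - x 0) = q + 18 := by
    rw [hq, sq_sum_eq, sq_sum_eq, h.e₁, h.e₂]
    ring
  have hdiscr : ((x 1 - x 0) * ((x 2 - x 1) * (x 2 - x 0))) ^ 2 =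
      ((τ 1 - τ 0) * ((τ 2 - τ 1) * (τ 2 - τ 0))) ^ 2 + 8 * (q ^ 2 + 18 * q + 108) := by
    rw [hq, sq_sum_eq, discr_eq, discr_eq, h.e₁, h.e₂, h.e₃]
    ring
  by_contra! hlt
  have hm : 0 ≤ (x 2 - x 1) * (x 2 - x 0) := mul_nonneg h12 (by linarith)
  have hprod : ((x 1 - x 0) * ((x 2 - x 1) * (x 2 - x 0))) ^ 2 ≤ (q + 18) ^ 2 := by
    refine pow_le_pow_left₀ (mul_nonneg h01 hm) ?_ 2
    nlinarith [mul_le_of_le_one_left hm hlt.le]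
  nlinarith [sq_nonneg ((τ 1 - τ 0) * ((τ 2 - τ 1) * (τ 2 - τ 0)))]

theorem one_le_sub (h : IsNuijPair τ x) {i j : Fin 3} (hij : i < j) : 1 ≤ x j - x i := by
  have h01 := h.one_le_one_sub_zero
  have h12 : 1 ≤ -x 1 - -x 2 := h.neg_comp_rev.one_le_one_sub_zero
  fin_cases i <;> fin_cases j <;> first | exact absurd hij (by decide) | (dsimp; linarith)

theorem strictMono_right (h : IsNuijPair τ x) : StrictMono x := fun _ _ hij =>
  sub_pos.1 (one_pos.trans_le (h.one_le_sub hij))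

theorem one_le_abs_sub (h : IsNuijPair τ x) {i j : Fin 3} (hij : i ≠ j) : 1 ≤ |x i - x j| := by
  rcases lt_or_gt_of_ne hij with hlt | hlt
  · rw [abs_sub_comm]
    exact (h.one_le_sub hlt).trans (le_abs_self _)
  · exact (h.one_le_sub hlt).trans (le_abs_self _)

end IsNuijPair

end Nuij

section Interpolation

variable {𝕜 ι : Type*} [NormedField 𝕜] [Fintype ι] [DecidableEq ι]

/-- The sum `∑ i, ‖N (x i)‖ / ∏ j ≠ i, ‖x i - x j‖` of the absolute values of the Lagrange
coefficients of `N` at the nodes `x`, the left-hand side of the Levi condition. -/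
noncomputable def lagrangeSum (N : 𝕜[X]) (x : ι → 𝕜) : ℝ :=
  ∑ i, ‖N.eval (x i)‖ / ∏ j ∈ Finset.univ.erase i, ‖x i - x j‖

theorem lagrangeSum_nonneg (N : 𝕜[X]) (x : ι → 𝕜) : 0 ≤ lagrangeSum N x := by
  unfold lagrangeSum
  positivity

theorem lagrangeSum_fin_three (N : 𝕜[X]) (x : Fin 3 → 𝕜) :
    lagrangeSum N x = ∑ q ∈ cyclicTriples,
      ‖N.eval (x q.1)‖ / (‖x q.1 - x q.2.1‖ * ‖x q.1 - x q.2.2‖) := by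
  have herase : Finset.univ.erase (0 : Fin 3) = {1, 2} ∧ Finset.univ.erase (1 : Fin 3) = {2, 0} ∧
      Finset.univ.erase (2 : Fin 3) = {0, 1} := by decide
  rw [lagrangeSum, Fin.sum_univ_three, herase.1, herase.2.1, herase.2.2,
    Finset.prod_pair (by decide), Finset.prod_pair (by decide), Finset.prod_pair (by decide),
    cyclicTriples, Finset.sum_insert (by decide), Finset.sum_pair (by decide), add_assoc]

theorem norm_eval_le_sum_lagrange {N : 𝕜[X]} {τ : ι → 𝕜} (hτ : τ.Injective)
    (hN : N.degree < Fintype.card ι) (y : 𝕜) :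
    ‖N.eval y‖ ≤ ∑ m, ‖N.eval (τ m)‖ / (∏ j ∈ Finset.univ.erase m, ‖τ m - τ j‖) *
      ∏ j ∈ Finset.univ.erase m, ‖y - τ j‖ := by
  conv_lhs => rw [Lagrange.eq_interpolate (s := Finset.univ) hτ.injOn hN]
  rw [Lagrange.interpolate_apply, eval_finsetSum]
  refine (norm_sum_le _ _).trans_eq (Finset.sum_congr rfl fun m _ => ?_)
  simp only [Lagrange.basis, Lagrange.basisDivisor, eval_mul, eval_C, eval_prod, eval_sub, eval_X,
    norm_mul, norm_prod, norm_inv, Finset.prod_mul_distrib, Finset.prod_inv_distrib, div_eq_mul_inv,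
    mul_assoc]

theorem prod_norm_sub_le_of_norm_sub_le {τ x : ι → 𝕜} {A : ℝ}
    (hx : Pairwise fun i j => 1 ≤ ‖x i - x j‖) (hxτ : ∀ i, ‖x i - τ i‖ ≤ A) (i m : ι) :
    ∏ j ∈ Finset.univ.erase m, ‖x i - τ j‖ ≤
      (1 + A) ^ (Fintype.card ι - 1) * ∏ j ∈ Finset.univ.erase i, ‖x i - x j‖ := by
  have hA : 0 ≤ A := (norm_nonneg _).trans (hxτ i)
  have hne {j : ι} (hj : i ≠ j) : ‖x i - τ j‖ ≤ (1 + A) * ‖x i - x j‖ := by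
    have := norm_sub_le_norm_sub_add_norm_sub (x i) (x j) (τ j)
    nlinarith [hx hj, hxτ j]
  have hself {j : ι} (hj : i ≠ j) : ‖x i - τ i‖ ≤ (1 + A) * ‖x i - x j‖ := by
    nlinarith [hx hj, hxτ i]
  rw [← Finset.card_univ, ← Finset.card_erase_of_mem (Finset.mem_univ i),
    Finset.pow_card_mul_prod]
  rcases eq_or_ne i m with rfl | him
  · exact Finset.prod_le_prod (fun _ _ => norm_nonneg _) fun j hj =>
      hne (Finset.ne_of_mem_erase hj).symm
  · have hi : i ∈ Finset.univ.erase m := Finset.mem_erase.2 ⟨him, Finset.mem_univ i⟩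
    have hm : m ∈ Finset.univ.erase i := Finset.mem_erase.2 ⟨him.symm, Finset.mem_univ m⟩
    rw [← Finset.mul_prod_erase _ _ hi, ← Finset.mul_prod_erase _ _ hm, Finset.erase_right_comm]
    refine mul_le_mul (hself him) (Finset.prod_le_prod (fun _ _ => norm_nonneg _) fun j hj => ?_)
      (by positivity) (by positivity)
    exact hne (Finset.ne_of_mem_erase (Finset.mem_of_mem_erase hj)).symm

theorem lagrangeSum_le_of_norm_sub_le {N : 𝕜[X]} {τ x : ι → 𝕜} {A : ℝ}
    (hN : N.degree < Fintype.card ι) (hτ : τ.Injective)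
    (hx : Pairwise fun i j => 1 ≤ ‖x i - x j‖) (hxτ : ∀ i, ‖x i - τ i‖ ≤ A) :
    lagrangeSum N x ≤
      Fintype.card ι * (1 + A) ^ (Fintype.card ι - 1) * lagrangeSum N τ := by
  have hpos (i : ι) : 0 < ∏ j ∈ Finset.univ.erase i, ‖x i - x j‖ := Finset.prod_pos fun j hj =>
    one_pos.trans_le (hx (Finset.ne_of_mem_erase hj).symm)
  have hterm (i : ι) : ‖N.eval (x i)‖ / ∏ j ∈ Finset.univ.erase i, ‖x i - x j‖ ≤
      (1 + A) ^ (Fintype.card ι - 1) * lagrangeSum N τ := by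
    rw [div_le_iff₀ (hpos i), mul_right_comm, lagrangeSum, Finset.mul_sum]
    refine (norm_eval_le_sum_lagrange hτ hN (x i)).trans (Finset.sum_le_sum fun m _ => ?_)
    rw [mul_comm _ (‖_‖ / _)]
    gcongr
    exact prod_norm_sub_le_of_norm_sub_le hx hxτ i m
  refine (Finset.sum_le_card_nsmul _ _ _ fun i _ => hterm i).trans_eq ?_
  rw [Finset.card_univ, nsmul_eq_mul, mul_assoc]

theorem continuousOn_lagrangeSum {X : Type*} [TopologicalSpace X] {S : Set X} {N : X → 𝕜[X]}
    {x : X → ι → 𝕜} (hx : ContinuousOn x S) (hinj : ∀ p ∈ S, (x p).Injective)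
    (hN : ∀ i, ContinuousOn (fun p => (N p).eval (x p i)) S) :
    ContinuousOn (fun p => lagrangeSum (N p) (x p)) S := by
  have hxi (i : ι) : ContinuousOn (fun p => x p i) S := continuousOn_pi.1 hx i
  refine continuousOn_finsetSum _ fun i _ => (hN i).norm.div
    (continuousOn_finsetProd _ fun j _ => ((hxi i).sub (hxi j)).norm) fun p hp => ?_
  exact Finset.prod_ne_zero_iff.2 fun j hj =>
    norm_ne_zero_iff.2 (sub_ne_zero.2 ((hinj p hp).ne (Finset.ne_of_mem_erase hj).symm))

theorem norm_mul_lagrangeSum_le {N : 𝕜[X]} {x : Fin 3 → 𝕜} {B : ℝ}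
    (h : ∀ q ∈ cyclicTriples, ‖x q.2.1 - x q.2.2‖ * ‖N.eval (x q.1)‖ ≤ B) :
    ‖x 0 - x 1‖ * ‖x 1 - x 2‖ * ‖x 2 - x 0‖ * lagrangeSum N x ≤ 3 * B := by
  have hvandermonde : ∀ q ∈ cyclicTriples, ‖x 0 - x 1‖ * ‖x 1 - x 2‖ * ‖x 2 - x 0‖ =
      ‖x q.2.1 - x q.2.2‖ * (‖x q.1 - x q.2.1‖ * ‖x q.1 - x q.2.2‖) := by
    simp only [cyclicTriples, Finset.forall_mem_insert, Finset.mem_singleton, forall_eq,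
      norm_sub_rev (x 0) (x 2), norm_sub_rev (x 1) (x 0), norm_sub_rev (x 2) (x 1)]
    exact ⟨by ring, by ring, by ring⟩
  rw [lagrangeSum_fin_three, Finset.mul_sum]
  refine (Finset.sum_le_card_nsmul _ _ B fun q hq => ?_).trans_eq ?_
  · rw [hvandermonde q hq]
    refine le_trans ?_ (h q hq)
    rw [mul_assoc, mul_div_left_comm]
    exact mul_le_mul_of_nonneg_left
      (mul_le_of_le_one_right (norm_nonneg _) (div_self_le_one _)) (norm_nonneg _)
  · rw [nsmul_eq_mul]
    rfl

end Interpolation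

section RootContinuity

open Filter Topology

variable {X ι : Type*} [Fintype ι]

theorem eventually_exists_abs_sub_lt {l : Filter X} {x : X → ι → ℝ} {u ε : ℝ} (hε : 0 < ε)
    (hu : Tendsto (fun p => ∏ i, (u - x p i)) l (𝓝 0)) : ∀ᶠ p in l, ∃ i, |u - x p i| < ε := by
  have hpow : 0 < ε ^ Fintype.card ι := pow_pos hε _
  filter_upwards [hu.abs.eventually_lt_const (by rwa [abs_zero])] with p hp
  by_contra! h
  refine hp.not_ge ?_
  rw [Finset.abs_prod, ← Finset.card_univ, ← Finset.prod_const]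
  exact Finset.prod_le_prod (fun _ _ => hε.le) fun i _ => h i

theorem continuousOn_of_strictMono_of_continuousOn_prod_sub [TopologicalSpace X] [LinearOrder ι]
    {S : Set X} {x : X → ι → ℝ} (hx : ∀ p ∈ S, StrictMono (x p))
    (hprod : ∀ u, ContinuousOn (fun p => ∏ i, (u - x p i)) S) :
    ContinuousOn x S := by
  intro p₀ hp₀
  have hgap : ∀ᶠ δ in 𝓝[>] (0 : ℝ), ∀ i j, i < j → x p₀ i + δ < x p₀ j - δ := by
    refine eventually_all.2 fun i => eventually_all.2 fun j => eventually_imp_distrib_left.2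
      fun hij => nhdsWithin_le_nhds ?_
    refine Tendsto.eventually_lt (Continuous.tendsto (by fun_prop) 0)
      (Continuous.tendsto (by fun_prop) 0) ?_
    simpa using hx p₀ hp₀ hij
  refine tendsto_pi_nhds.2 fun i => Metric.tendsto_nhds.2 fun ε hε => ?_
  obtain ⟨δ, hδgap, hδ0, hδε⟩ := (hgap.and (Ioo_mem_nhdsGT hε)).exists
  have hzero (j : ι) : ∏ k, (x p₀ j - x p₀ k) = 0 :=
    Finset.prod_eq_zero (Finset.mem_univ j) (sub_self _)
  have hnear : ∀ᶠ p in 𝓝[S] p₀, ∀ j, ∃ k, |x p₀ j - x p k| < δ :=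
    eventually_all.2 fun j =>
      eventually_exists_abs_sub_lt hδ0 (hzero j ▸ (hprod (x p₀ j)).continuousWithinAt hp₀)
  filter_upwards [hnear, self_mem_nhdsWithin] with p hp hpS
  choose k hk using hp
  have hmono : StrictMono k := fun a b hab => (hx p hpS).lt_iff_lt.1 <| by
    linarith [(abs_lt.1 (hk a)).1, (abs_lt.1 (hk b)).2, hδgap a b hab]
  have hki := hk i
  rw [hmono.eq_id, id, abs_sub_comm] at hki
  exact hki.trans hδε

end RootContinuity

section PolynomialGrowth

variable {X E F : Type*} [NormedAddCommGroup E] [NormedAddCommGroup F] {I : Set X}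

/-- `G t ξ` grows at most polynomially in `ξ`, uniformly in `t ∈ I`. -/
def HasPolynomialGrowth (I : Set X) (G : X → E → F) : Prop :=
  ∃ (K : ℝ) (N : ℕ), 0 ≤ K ∧ ∀ t ∈ I, ∀ ξ, ‖G t ξ‖ ≤ K * (1 + ‖ξ‖) ^ N

namespace HasPolynomialGrowth

theorem const (c : F) : HasPolynomialGrowth I (fun _ (_ : E) => c) :=
  ⟨‖c‖, 0, norm_nonneg c, fun t _ ξ => by simp⟩

theorem mono {F' : Type*} [NormedAddCommGroup F'] {G : X → E → F} {H : X → E → F'}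
    (hG : HasPolynomialGrowth I G) (h : ∀ t ∈ I, ∀ ξ, ‖H t ξ‖ ≤ ‖G t ξ‖) :
    HasPolynomialGrowth I H := by
  obtain ⟨K, N, hK, hb⟩ := hG
  exact ⟨K, N, hK, fun t ht ξ => (h t ht ξ).trans (hb t ht ξ)⟩

theorem norm {G : X → E → F} (hG : HasPolynomialGrowth I G) :
    HasPolynomialGrowth I (fun t ξ => ‖G t ξ‖) :=
  hG.mono fun t _ ξ => (norm_norm (G t ξ)).le

theorem add {G H : X → E → F} (hG : HasPolynomialGrowth I G) (hH : HasPolynomialGrowth I H) :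
    HasPolynomialGrowth I (fun t ξ => G t ξ + H t ξ) := by
  obtain ⟨K, N, hK, hb⟩ := hG
  obtain ⟨K', N', hK', hb'⟩ := hH
  refine ⟨K + K', max N N', by positivity, fun t ht ξ => (norm_add_le _ _).trans ?_⟩
  have h1 : 1 ≤ 1 + ‖ξ‖ := by linarith [norm_nonneg ξ]
  rw [add_mul]
  refine add_le_add ((hb t ht ξ).trans ?_) ((hb' t ht ξ).trans ?_)
  · exact mul_le_mul_of_nonneg_left (pow_le_pow_right₀ h1 (le_max_left _ _)) hK
  · exact mul_le_mul_of_nonneg_left (pow_le_pow_right₀ h1 (le_max_right _ _)) hK'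

theorem smul {𝕜 : Type*} [NormedField 𝕜] [NormedSpace 𝕜 F] {G : X → E → 𝕜} {H : X → E → F}
    (hG : HasPolynomialGrowth I G) (hH : HasPolynomialGrowth I H) :
    HasPolynomialGrowth I (fun t ξ => G t ξ • H t ξ) := by
  obtain ⟨K, N, hK, hb⟩ := hG
  obtain ⟨K', N', hK', hb'⟩ := hH
  refine ⟨K * K', N + N', by positivity, fun t ht ξ => ?_⟩
  rw [norm_smul, pow_add, mul_mul_mul_comm]
  exact mul_le_mul (hb t ht ξ) (hb' t ht ξ) (norm_nonneg _) (by positivity)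

theorem sum {ι : Type*} (S : Finset ι) {G : ι → X → E → F}
    (h : ∀ i ∈ S, HasPolynomialGrowth I (G i)) :
    HasPolynomialGrowth I (fun t ξ => ∑ i ∈ S, G i t ξ) := by
  classical
  induction S using Finset.induction_on with
  | empty => simpa only [Finset.sum_empty] using const 0
  | insert a S ha ih =>
    simp only [Finset.sum_insert ha]
    exact (h a (Finset.mem_insert_self a S)).add
      (ih fun i hi => h i (Finset.mem_insert_of_mem hi))

end HasPolynomialGrowth

end PolynomialGrowth

section Separable

variable {E : Type*} {I : Set ℝ} {G H : ℝ → E → ℝ}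

/-- `G t ξ` is a finite sum of products of a function of `ξ` and a function of `t` which is
analytic on `I`. -/
def IsSeparableAnalytic (I : Set ℝ) (G : ℝ → E → ℝ) : Prop :=
  ∃ (ι : Type) (_ : Fintype ι) (f : ι → ℝ → ℝ) (c : ι → E → ℝ),
    (∀ i, AnalyticOnNhd ℝ (f i) I) ∧ ∀ t ξ, G t ξ = ∑ i, c i ξ * f i t

theorem analyticOnNhd_toLp {ι : Type*} [Fintype ι] {f : ι → ℝ → ℝ}
    (hf : ∀ i, AnalyticOnNhd ℝ (f i) I) :
    AnalyticOnNhd ℝ (fun t => WithLp.toLp 2 fun i => f i t) I := fun t ht =>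
  ((EuclideanSpace.equiv ι ℝ).symm.toContinuousLinearMap.analyticAt _).comp
    (AnalyticAt.pi fun i => hf i t ht)

namespace IsSeparableAnalytic

theorem exists_eq_inner (hG : IsSeparableAnalytic I G) :
    ∃ (ι : Type) (_ : Fintype ι) (c : E → EuclideanSpace ℝ ι) (γ : ℝ → EuclideanSpace ℝ ι),
      AnalyticOnNhd ℝ γ I ∧ ∀ t ξ, G t ξ = inner ℝ (c ξ) (γ t) := by
  obtain ⟨ι, _, f, c, hf, hG⟩ := hG
  refine ⟨ι, ‹_›, fun ξ => WithLp.toLp 2 fun i => c i ξ, _, analyticOnNhd_toLp hf, fun t ξ => ?_⟩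
  simp only [hG, PiLp.inner_apply, RCLike.inner_apply, conj_trivial, mul_comm]

theorem const (a : ℝ) : IsSeparableAnalytic I (fun _ (_ : E) => a) :=
  ⟨Unit, inferInstance, fun _ _ => 1, fun _ _ => a, fun _ => analyticOnNhd_const, by simp⟩

theorem add (hG : IsSeparableAnalytic I G) (hH : IsSeparableAnalytic I H) :
    IsSeparableAnalytic I (fun t ξ => G t ξ + H t ξ) := by
  obtain ⟨ι, _, f, c, hf, hG⟩ := hG
  obtain ⟨κ, _, g, d, hg, hH⟩ := hH
  refine ⟨ι ⊕ κ, inferInstance, Sum.elim f g, Sum.elim c d, Sum.rec hf hg, fun t ξ => ?_⟩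
  simp only [hG, hH, Fintype.sum_sum_type, Sum.elim_inl, Sum.elim_inr]

theorem mul (hG : IsSeparableAnalytic I G) (hH : IsSeparableAnalytic I H) :
    IsSeparableAnalytic I (fun t ξ => G t ξ * H t ξ) := by
  obtain ⟨ι, _, f, c, hf, hG⟩ := hG
  obtain ⟨κ, _, g, d, hg, hH⟩ := hH
  refine ⟨ι × κ, inferInstance, fun i t => f i.1 t * g i.2 t, fun i ξ => c i.1 ξ * d i.2 ξ,
    fun i => (hf i.1).mul (hg i.2), fun t ξ => ?_⟩
  simp only [hG, hH, Fintype.sum_mul_sum, Fintype.sum_prod_type]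
  exact Finset.sum_congr rfl fun i _ => Finset.sum_congr rfl fun j _ => mul_mul_mul_comm _ _ _ _

theorem discr {a b c d : ℝ → E → ℝ} (ha : IsSeparableAnalytic I a) (hb : IsSeparableAnalytic I b)
    (hc : IsSeparableAnalytic I c) (hd : IsSeparableAnalytic I d) :
    IsSeparableAnalytic I (fun t ξ => Cubic.discr ⟨a t ξ, b t ξ, c t ξ, d t ξ⟩) := by
  have hsum := (((((hb.mul hb).mul (hc.mul hc)).add
    ((const (-4)).mul (ha.mul (hc.mul (hc.mul hc))))).add
    ((const (-4)).mul (hb.mul (hb.mul (hb.mul hd))))).add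
    ((const (-27)).mul ((ha.mul ha).mul (hd.mul hd)))).add
    ((const 18).mul ((ha.mul hb).mul (hc.mul hd)))
  convert hsum using 3 with t ξ
  simp only [Cubic.discr]
  ring

end IsSeparableAnalytic

end Separable

section MonomialSum

variable {n : ℕ} {F : Type*} [NormedAddCommGroup F] [NormedSpace ℝ F]
  {S : Finset (Fin n → ℕ)} {f : (Fin n → ℕ) → ℝ → F} {I : Set ℝ}

/-- The symbol `∑_{α ∈ S} f_α(t) ξ^α`. -/
noncomputable def monomialSum (S : Finset (Fin n → ℕ)) (f : (Fin n → ℕ) → ℝ → F) (t : ℝ)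
    (ξ : EuclideanSpace ℝ (Fin n)) : F :=
  ∑ α ∈ S, (∏ i, ξ i ^ α i) • f α t

theorem continuousOn_monomialSum (hf : ∀ α ∈ S, ContinuousOn (f α) I) :
    ContinuousOn (fun p : ℝ × EuclideanSpace ℝ (Fin n) => monomialSum S f p.1 p.2)
      (I ×ˢ univ) := by
  refine continuousOn_finsetSum _ fun α hα => ContinuousOn.smul (by fun_prop) ?_
  exact (hf α hα).comp continuousOn_fst fun p hp => hp.1

theorem hasDerivAt_monomialSum {t : ℝ} (hf : ∀ α ∈ S, DifferentiableAt ℝ (f α) t)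
    (ξ : EuclideanSpace ℝ (Fin n)) :
    HasDerivAt (fun s => monomialSum S f s ξ) (monomialSum S (fun α => deriv (f α)) t ξ) t :=
  HasDerivAt.fun_sum fun α hα => ((hf α hα).hasDerivAt).const_smul _

theorem analyticOnNhd_monomialSum (S : Finset (Fin n → ℕ)) (f : (Fin n → ℕ) → ℝ → ℝ) (t : ℝ) :
    AnalyticOnNhd ℝ (monomialSum S f t) univ := by
  intro ξ _
  have hcoord (i : Fin n) : AnalyticAt ℝ (fun ξ : EuclideanSpace ℝ (Fin n) => ξ i) ξ :=
    (EuclideanSpace.proj i : EuclideanSpace ℝ (Fin n) →L[ℝ] ℝ).analyticAt ξ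
  unfold monomialSum
  fun_prop

theorem isSeparableAnalytic_monomialSum {f : (Fin n → ℕ) → ℝ → ℝ}
    (hf : ∀ α ∈ S, AnalyticOnNhd ℝ (f α) I) : IsSeparableAnalytic I (monomialSum S f) :=
  ⟨S, inferInstance, fun α => f α, fun α ξ => ∏ i, ξ i ^ α.1 i, fun α => hf α α.2,
    fun t ξ => (Finset.sum_coe_sort S fun α => (∏ i, ξ i ^ α i) * f α t).symm⟩

theorem abs_prod_pow_le (ξ : EuclideanSpace ℝ (Fin n)) (α : Fin n → ℕ) :
    |∏ i, ξ i ^ α i| ≤ (1 + ‖ξ‖) ^ ∑ i, α i := by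
  rw [Finset.abs_prod, ← Finset.prod_pow_eq_pow_sum]
  refine Finset.prod_le_prod (fun i _ => abs_nonneg _) fun i _ => ?_
  rw [abs_pow]
  have h1 : |ξ i| ≤ ‖ξ‖ := PiLp.norm_apply_le ξ i
  exact pow_le_pow_left₀ (abs_nonneg _) (by linarith) _

theorem hasPolynomialGrowth_monomialSum (hI : IsCompact I) (hf : ∀ α ∈ S, ContinuousOn (f α) I) :
    HasPolynomialGrowth I (monomialSum S f) := by
  refine .sum S fun α hα => .smul ⟨1, ∑ i, α i, zero_le_one, fun t _ ξ => ?_⟩ ?_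
  · rw [one_mul]
    exact abs_prod_pow_le ξ α
  · obtain ⟨K, hK⟩ := hI.exists_bound_of_continuousOn (hf α hα)
    refine ⟨|K|, 0, abs_nonneg K, fun t ht ξ => ?_⟩
    rw [pow_zero, mul_one]
    exact (hK t ht).trans (le_abs_self K)

end MonomialSum

section Symbols

namespace ThirdOrderOperator

variable {n : ℕ} {P : ThirdOrderOperator n} {T : ℝ}

/-- The coefficient of `τ ^ j` in the principal symbol. -/
noncomputable def topSymbol (P : ThirdOrderOperator n) (j : ℕ) :
    ℝ → EuclideanSpace ℝ (Fin n) → ℝ :=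
  monomialSum (Finset.piAntidiag Finset.univ (3 - j)) (P.top j)

/-- The time derivative of the coefficient of `τ ^ j` in the principal symbol. -/
noncomputable def topSymbolDeriv (P : ThirdOrderOperator n) (j : ℕ) :
    ℝ → EuclideanSpace ℝ (Fin n) → ℝ :=
  monomialSum (Finset.piAntidiag Finset.univ (3 - j)) fun α => deriv (P.top j α)

/-- The coefficient of `τ ^ j` in the second order symbol `M`. -/
noncomputable def lowSymbol (P : ThirdOrderOperator n) (j : ℕ) :
    ℝ → EuclideanSpace ℝ (Fin n) → ℂ :=
  monomialSum (Finset.piAntidiag Finset.univ (2 - j)) (P.low j)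

/-- The principal symbol `L(t,·,ξ)`, as a cubic given by its coefficients. -/
noncomputable def topCubic (P : ThirdOrderOperator n) (t : ℝ) (ξ : EuclideanSpace ℝ (Fin n)) :
    Cubic ℝ :=
  ⟨1, P.topSymbol 2 t ξ, P.topSymbol 1 t ξ, P.topSymbol 0 t ξ⟩

/-- The modified symbol `M̌(t,·,ξ)`, as a polynomial. -/
noncomputable def mCheckPoly (P : ThirdOrderOperator n) (t : ℝ) (ξ : EuclideanSpace ℝ (Fin n)) :
    ℂ[X] :=
  C (P.lowSymbol 2 t ξ) * X ^ 2 + C (P.lowSymbol 1 t ξ - (P.topSymbolDeriv 2 t ξ : ℝ)) * X +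
    C (P.lowSymbol 0 t ξ - (1 / 2 * P.topSymbolDeriv 1 t ξ : ℝ))

/-- The regularity needed for the Levi condition: real analytic coefficients in the principal part
and continuous ones in the second order part. The coefficients with `j + |α| ≤ 1` do not enter
`M`, so nothing is asked of them. -/
structure RegularCoeffs (P : ThirdOrderOperator n) (T : ℝ) : Prop where
  analyticOnNhd_top (j : ℕ) (α : Fin n → ℕ) (hj : j ≤ 2) (hα : j + ∑ i, α i = 3) :
    AnalyticOnNhd ℝ (P.top j α) (Icc 0 T)
  continuousOn_low (j : ℕ) (α : Fin n → ℕ) (hα : j + ∑ i, α i = 2) :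
    ContinuousOn (P.low j α) (Icc 0 T)

theorem AnalyticCoeffs.regularCoeffs (h : P.AnalyticCoeffs T) : P.RegularCoeffs T :=
  ⟨h.1, fun j α hα => (h.2 j α hα.le).continuousOn⟩

theorem L_eq_toPoly (P : ThirdOrderOperator n) (t : ℝ) (ξ : EuclideanSpace ℝ (Fin n)) :
    P.L t ξ = (P.topCubic t ξ).toPoly := by
  have hj (j : ℕ) : ∑ α ∈ Finset.piAntidiag (Finset.univ : Finset (Fin n)) (3 - j),
      C (P.top j α t * ∏ i, ξ i ^ α i) * X ^ j = C (P.topSymbol j t ξ) * X ^ j := by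
    rw [topSymbol, monomialSum, map_sum, Finset.sum_mul]
    exact Finset.sum_congr rfl fun α _ => by rw [smul_eq_mul, mul_comm (P.top j α t)]
  simp only [L, hj, Finset.sum_range_succ, Finset.sum_range_zero, topCubic, Cubic.toPoly, map_one]
  ring

theorem calL_eq_toPoly (P : ThirdOrderOperator n) (t : ℝ) (ξ : EuclideanSpace ℝ (Fin n)) :
    P.calL t ξ = (nuijCubic (P.topCubic t ξ)).toPoly := by
  rw [calL, L_eq_toPoly, toPoly_nuijCubic]

theorem M_eq (P : ThirdOrderOperator n) (t τ : ℝ) (ξ : EuclideanSpace ℝ (Fin n)) :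
    P.M t τ ξ = P.lowSymbol 0 t ξ + P.lowSymbol 1 t ξ * τ + P.lowSymbol 2 t ξ * τ ^ 2 := by
  have hj (j : ℕ) : ∑ α ∈ Finset.piAntidiag (Finset.univ : Finset (Fin n)) (2 - j),
      P.low j α t * ((τ ^ j * ∏ i, ξ i ^ α i : ℝ) : ℂ) = P.lowSymbol j t ξ * τ ^ j := by
    rw [lowSymbol, monomialSum, Finset.sum_mul]
    refine Finset.sum_congr rfl fun α _ => ?_
    rw [Complex.real_smul, Complex.ofReal_mul, Complex.ofReal_pow]
    ring
  simp only [M, hj, Finset.sum_range_succ, Finset.sum_range_zero]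
  ring

theorem eval_mCheckPoly_eq (P : ThirdOrderOperator n) (t : ℝ) (ξ : EuclideanSpace ℝ (Fin n))
    (z : ℂ) : (P.mCheckPoly t ξ).eval z = P.lowSymbol 2 t ξ * z ^ 2 +
      (P.lowSymbol 1 t ξ - (P.topSymbolDeriv 2 t ξ : ℝ)) * z +
      (P.lowSymbol 0 t ξ - (1 / 2 * P.topSymbolDeriv 1 t ξ : ℝ)) := by
  simp only [mCheckPoly, eval_add, eval_mul, eval_C, eval_pow, eval_X]

theorem analyticOnNhd_discr_topCubic (P : ThirdOrderOperator n) (t : ℝ) :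
    AnalyticOnNhd ℝ (fun ξ => (P.topCubic t ξ).discr) univ := by
  intro ξ _
  have hcoeff (j : ℕ) : AnalyticAt ℝ (P.topSymbol j t) ξ :=
    analyticOnNhd_monomialSum _ _ t ξ (mem_univ ξ)
  simp only [Cubic.discr, topCubic]
  fun_prop

namespace RegularCoeffs

theorem analyticOnNhd_top_of_mem (h : P.RegularCoeffs T) {j : ℕ} (hj : j ≤ 2) {α : Fin n → ℕ}
    (hα : α ∈ Finset.piAntidiag (Finset.univ : Finset (Fin n)) (3 - j)) :
    AnalyticOnNhd ℝ (P.top j α) (Icc 0 T) := by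
  have hsum : ∑ i, α i = 3 - j := (Finset.mem_piAntidiag.1 hα).1
  exact h.analyticOnNhd_top j α hj (by lia)

theorem continuousOn_low_of_mem (h : P.RegularCoeffs T) {j : ℕ} (hj : j ≤ 2) {α : Fin n → ℕ}
    (hα : α ∈ Finset.piAntidiag (Finset.univ : Finset (Fin n)) (2 - j)) :
    ContinuousOn (P.low j α) (Icc 0 T) := by
  have hsum : ∑ i, α i = 2 - j := (Finset.mem_piAntidiag.1 hα).1
  exact h.continuousOn_low j α (by lia)

theorem hasDerivAt_topSymbol (h : P.RegularCoeffs T) {j : ℕ} (hj : j ≤ 2) {t : ℝ}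
    (ht : t ∈ Icc 0 T) (ξ : EuclideanSpace ℝ (Fin n)) :
    HasDerivAt (fun s => P.topSymbol j s ξ) (P.topSymbolDeriv j t ξ) t :=
  hasDerivAt_monomialSum (fun _ hα => (h.analyticOnNhd_top_of_mem hj hα t ht).differentiableAt) ξ

theorem eval_mCheckPoly (h : P.RegularCoeffs T) {t : ℝ} (ht : t ∈ Icc 0 T) (τ : ℝ)
    (ξ : EuclideanSpace ℝ (Fin n)) : (P.mCheckPoly t ξ).eval (τ : ℂ) = P.MCheck t τ ξ := by
  have heval : (fun s => (derivative (P.L s ξ)).eval τ) =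
      fun s => 3 * τ ^ 2 + P.topSymbol 2 s ξ * (2 * τ) + P.topSymbol 1 s ξ := by
    funext s
    simp only [L_eq_toPoly, topCubic, Cubic.toPoly, map_one, one_mul,
      derivative_X_pow_succ, Nat.cast_ofNat, map_add, derivative_mul, derivative_C, zero_mul,
      Nat.cast_one, pow_one, zero_add, derivative_X, mul_one, add_zero, eval_add, eval_mul, eval_C,
      eval_one, eval_pow, eval_X]
    ring
  have hderiv : HasDerivAt
      (fun s => 3 * τ ^ 2 + P.topSymbol 2 s ξ * (2 * τ) + P.topSymbol 1 s ξ)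
      (P.topSymbolDeriv 2 t ξ * (2 * τ) + P.topSymbolDeriv 1 t ξ) t :=
    (((h.hasDerivAt_topSymbol le_rfl ht ξ).mul_const (2 * τ)).const_add (3 * τ ^ 2)).add
      (h.hasDerivAt_topSymbol one_le_two ht ξ)
  rw [MCheck, heval, hderiv.deriv, M_eq, eval_mCheckPoly_eq]
  push_cast
  ring

theorem isSeparableAnalytic_discr_topCubic (h : P.RegularCoeffs T) :
    IsSeparableAnalytic (Icc 0 T) fun t ξ => (P.topCubic t ξ).discr := by
  have hcoeff {j : ℕ} (hj : j ≤ 2) : IsSeparableAnalytic (Icc 0 T) (P.topSymbol j) :=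
    isSeparableAnalytic_monomialSum fun _ hα => h.analyticOnNhd_top_of_mem hj hα
  exact .discr (.const 1) (hcoeff le_rfl) (hcoeff one_le_two) (hcoeff zero_le_two)

end RegularCoeffs

theorem degree_mCheckPoly_lt (P : ThirdOrderOperator n) (t : ℝ) (ξ : EuclideanSpace ℝ (Fin n)) :
    (P.mCheckPoly t ξ).degree < 3 :=
  degree_quadratic_lt

namespace WeaklyHyperbolic

theorem splits_topCubic (h : P.WeaklyHyperbolic T) {t : ℝ} (ht : t ∈ Icc 0 T)
    (ξ : EuclideanSpace ℝ (Fin n)) : (P.topCubic t ξ).toPoly.Splits :=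
  P.L_eq_toPoly t ξ ▸ h t ht ξ

theorem splits_calL (h : P.WeaklyHyperbolic T) {t : ℝ} (ht : t ∈ Icc 0 T)
    (ξ : EuclideanSpace ℝ (Fin n)) : (P.calL t ξ).Splits :=
  P.calL_eq_toPoly t ξ ▸ splits_nuijCubic one_ne_zero (h.splits_topCubic ht ξ)

theorem nodup_roots_calL (h : P.WeaklyHyperbolic T) {t : ℝ} (ht : t ∈ Icc 0 T)
    (ξ : EuclideanSpace ℝ (Fin n)) : (P.calL t ξ).roots.Nodup :=
  P.calL_eq_toPoly t ξ ▸ nodup_roots_nuijCubic one_ne_zero (h.splits_topCubic ht ξ)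

theorem isNuijPair (h : P.WeaklyHyperbolic T) {t : ℝ} (ht : t ∈ Icc 0 T)
    (ξ : EuclideanSpace ℝ (Fin n)) : IsNuijPair (P.tau · t ξ) (P.lam · t ξ) := by
  have hroots := isNuijPair_orderedRoot one_ne_zero (h.splits_topCubic ht ξ)
  rwa [← L_eq_toPoly, ← calL_eq_toPoly] at hroots

theorem discrL_eq (h : P.WeaklyHyperbolic T) {t : ℝ} (ht : t ∈ Icc 0 T)
    (ξ : EuclideanSpace ℝ (Fin n)) : P.discrL t ξ = (P.topCubic t ξ).discr := by
  rw [sq_discr_roots_eq one_ne_zero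
    (cubic_roots_eq_orderedRoot one_ne_zero (h.splits_topCubic ht ξ)), ← L_eq_toPoly]
  simp only [discrL, tau, topCubic]
  ring

end WeaklyHyperbolic

theorem leviIntegrand_eq_lagrangeSum (h : P.RegularCoeffs T) {t : ℝ} (ht : t ∈ Icc 0 T)
    (ξ : EuclideanSpace ℝ (Fin n)) :
    P.leviIntegrand ξ t = lagrangeSum (P.mCheckPoly t ξ) fun j => (P.lam j t ξ : ℂ) := by
  simp only [lagrangeSum_fin_three, leviIntegrand, h.eval_mCheckPoly ht, ← Complex.ofReal_sub,
    Complex.norm_real, Real.norm_eq_abs]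

end ThirdOrderOperator

end Symbols

section LogarithmicBounds

open Filter Topology

theorem log_mul_pow_le {A r s : ℝ} (hA : 1 ≤ A) (hr : 0 < r) (hrs : r ≤ s) (N : ℕ) :
    Real.log (A * (1 + s) ^ N) ≤ (Real.log A / Real.log (1 + r) + N) * Real.log (1 + s) := by
  have hlog : 0 < Real.log (1 + r) := Real.log_pos (by linarith)
  have hmono : Real.log (1 + r) ≤ Real.log (1 + s) := Real.log_le_log (by linarith) (by linarith)
  rw [Real.log_mul (by linarith) (pow_ne_zero N (by linarith)), Real.log_pow, add_mul,
    div_mul_eq_mul_div]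
  gcongr
  exact (le_div_iff₀ hlog).2 (mul_le_mul_of_nonneg_left hmono (Real.log_nonneg hA))

theorem IsSeparableAnalytic.exists_forall_hasLogDerivBound {E : Type*} {I : Set ℝ}
    (hI : I.OrdConnected) (hI' : IsCompact I) {D : ℝ → E → ℝ} (hD : IsSeparableAnalytic I D) :
    ∃ L, ∀ ξ, (∃ t ∈ I, D t ξ ≠ 0) → HasLogDerivBound (D · ξ) I I L := by
  obtain ⟨ι, _, c, γ, hγ, hD⟩ := hD.exists_eq_inner
  obtain ⟨L, hL⟩ := exists_forall_hasLogDerivBound_inner hI hI' hγ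
  exact ⟨L, fun ξ => by simpa only [hD] using hL (c ξ)⟩

theorem exists_forall_setLIntegral_le_log {E : Type*} [NormedAddCommGroup E] {I : Set ℝ}
    (hI : I.OrdConnected) (hI' : IsCompact I) {u D : ℝ → E → ℝ} {K r : ℝ} (hK : 0 < K) (hr : 0 < r)
    (hu : HasPolynomialGrowth I u) (hD : IsSeparableAnalytic I D)
    (hD0 : ∀ t ∈ I, ∀ ξ, 0 ≤ D t ξ)
    (huD : ∀ t ∈ I, ∀ ξ, u t ξ * D t ξ ≤ K * (D t ξ + |deriv (D · ξ) t|)) :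
    ∃ C : ℝ, 0 ≤ C ∧ ∀ ξ, r ≤ ‖ξ‖ → (∃ t ∈ I, D t ξ ≠ 0) →
      ∫⁻ t in I, ENNReal.ofReal (u t ξ) ≤ ENNReal.ofReal (C * Real.log (1 + ‖ξ‖)) := by
  obtain ⟨A, N, hA, hu⟩ := hu
  obtain ⟨L, hL⟩ := hD.exists_forall_hasLogDerivBound hI hI'
  have hB : 2 ≤ 2 + A / K := le_add_of_nonneg_right (by positivity)
  have hB0 : 0 ≤ Real.log (2 + A / K) := Real.log_nonneg (one_le_two.trans hB)
  have hr0 : 0 < Real.log (1 + r) := Real.log_pos (by linarith)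
  refine ⟨K * (L * (Real.log (2 + A / K) / Real.log (1 + r) + N)), by positivity,
    fun ξ hξ hne => ?_⟩
  have hpow : 1 ≤ (1 + ‖ξ‖) ^ N := one_le_pow₀ (by linarith [norm_nonneg ξ])
  have huK {t : ℝ} (ht : t ∈ I) : u t ξ ≤ K * ((2 + A / K) * (1 + ‖ξ‖) ^ N) :=
    calc u t ξ ≤ A * (1 + ‖ξ‖) ^ N := (le_abs_self _).trans (hu t ht ξ)
      _ = K * (A / K * (1 + ‖ξ‖) ^ N) := by rw [← mul_assoc, mul_div_cancel₀ _ hK.ne']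
      _ ≤ K * ((2 + A / K) * (1 + ‖ξ‖) ^ N) := by
        gcongr
        exact le_add_of_nonneg_left zero_le_two
  refine ((hL ξ hne).lintegral_le_of_mul_le hK (by nlinarith) fun t ht =>
    ⟨hD0 t ht ξ, huK ht, huD t ht ξ⟩).trans (ENNReal.ofReal_le_ofReal ?_)
  rw [mul_assoc, mul_assoc]
  gcongr
  exact log_mul_pow_le (one_le_two.trans hB) hr hξ N

theorem continuous_intervalIntegral_of_continuousOn {X : Type*} [TopologicalSpace X]
    [FirstCountableTopology X] [LocallyCompactSpace X] {a b : ℝ} (hab : a ≤ b) {u : ℝ → X → ℝ}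
    (hu : ContinuousOn (fun p : ℝ × X => u p.1 p.2) (Icc a b ×ˢ univ)) :
    Continuous fun ξ => ∫ t in a..b, u t ξ := by
  have hproj : Continuous (fun p : X × ℝ => u (projIcc a b hab p.2) p.1) :=
    hu.comp_continuous (f := fun p : X × ℝ => ((projIcc a b hab p.2 : ℝ), p.1))
      (((continuous_subtype_val.comp continuous_projIcc).comp continuous_snd).prodMk
        continuous_fst) fun p => ⟨(projIcc a b hab p.2).2, mem_univ _⟩
  refine (intervalIntegral.continuous_parametric_intervalIntegral_of_continuous'
    (f := fun ξ t => u (projIcc a b hab t) ξ) hproj a b).congr fun ξ =>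
      intervalIntegral.integral_congr fun t ht => ?_
  rw [uIcc_of_le hab] at ht
  simp only [projIcc_of_mem hab ht]

theorem exists_forall_intervalIntegral_le_log {E : Type*} [NormedAddCommGroup E]
    [LocallyCompactSpace E] {a b : ℝ} (hab : a ≤ b) {u D : ℝ → E → ℝ} {K r : ℝ} (hK : 0 < K)
    (hr : 0 < r) (hu0 : ∀ t ξ, 0 ≤ u t ξ)
    (huc : ContinuousOn (fun p : ℝ × E => u p.1 p.2) (Icc a b ×ˢ univ))
    (hu : HasPolynomialGrowth (Icc a b) u) (hD : IsSeparableAnalytic (Icc a b) D)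
    (hD0 : ∀ t ∈ Icc a b, ∀ ξ, 0 ≤ D t ξ) {t₀ : ℝ} (ht₀ : t₀ ∈ Icc a b)
    (hdense : Dense {ξ | D t₀ ξ ≠ 0})
    (huD : ∀ t ∈ Icc a b, ∀ ξ, u t ξ * D t ξ ≤ K * (D t ξ + |deriv (D · ξ) t|)) :
    ∃ C : ℝ, 0 ≤ C ∧ ∀ ξ, r ≤ ‖ξ‖ → ∫ t in a..b, u t ξ ≤ C * Real.log (1 + ‖ξ‖) := by
  obtain ⟨C, hC, hbound⟩ := exists_forall_setLIntegral_le_log ordConnected_Icc isCompact_Icc hK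
    (half_pos hr) hu hD hD0 huD
  have hgeneric : {ξ | r / 2 < ‖ξ‖} ∩ {ξ | D t₀ ξ ≠ 0} ⊆
      {ξ | ∫ t in a..b, u t ξ ≤ C * Real.log (1 + ‖ξ‖)} := by
    rintro ξ ⟨hξ, hne⟩
    have hlog : 0 ≤ Real.log (1 + ‖ξ‖) := Real.log_nonneg (by linarith [norm_nonneg ξ])
    have huξ : ContinuousOn (u · ξ) (Icc a b) := huc.uncurry_right ξ (mem_univ ξ)
    rw [mem_ofPred_eq, intervalIntegral.integral_of_le hab, ← integral_Icc_eq_integral_Ioc,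
      integral_eq_lintegral_of_nonneg_ae (Eventually.of_forall fun t => hu0 t ξ)
        (huξ.aestronglyMeasurable measurableSet_Icc)]
    exact ENNReal.toReal_le_of_le_ofReal (mul_nonneg hC hlog) (hbound ξ hξ.le ⟨t₀, ht₀, hne⟩)
  have hclosed : IsClosed {ξ : E | ∫ t in a..b, u t ξ ≤ C * Real.log (1 + ‖ξ‖)} :=
    isClosed_le (continuous_intervalIntegral_of_continuousOn hab huc)
      (continuous_const.mul ((continuous_const.add continuous_norm).log fun ξ =>
        (add_pos_of_pos_of_nonneg one_pos (norm_nonneg ξ)).ne'))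
  refine ⟨C, hC, fun ξ hξ => closure_minimal hgeneric hclosed ?_⟩
  exact hdense.open_subset_closure_inter (isOpen_lt continuous_const continuous_norm)
    ((half_lt_self hr).trans_le hξ)

end LogarithmicBounds

section Levi

namespace ThirdOrderOperator

open Filter Topology

variable {n : ℕ} {P : ThirdOrderOperator n} {T : ℝ}

theorem leviIntegrand_nonneg (P : ThirdOrderOperator n) (ξ : EuclideanSpace ℝ (Fin n)) (t : ℝ) :
    0 ≤ P.leviIntegrand ξ t := by
  unfold leviIntegrand
  positivity

theorem dense_discr_topCubic_ne_zero {t : ℝ} {ξ₀ : EuclideanSpace ℝ (Fin n)}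
    (h : (P.topCubic t ξ₀).discr ≠ 0) : Dense {ξ | (P.topCubic t ξ).discr ≠ 0} := by
  intro ξ
  rw [mem_closure_iff_frequently]
  intro hzero
  refine h (congrFun ((P.analyticOnNhd_discr_topCubic t).eq_of_eventuallyEq
    (g := fun _ => 0) analyticOnNhd_const (z₀ := ξ) ?_) ξ₀)
  filter_upwards [hzero] with ζ hζ using not_not.1 hζ

namespace RegularCoeffs

theorem differentiableAt_discr_topCubic (h : P.RegularCoeffs T) {t : ℝ} (ht : t ∈ Icc 0 T)
    (ξ : EuclideanSpace ℝ (Fin n)) :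
    DifferentiableAt ℝ (fun s => (P.topCubic s ξ).discr) t := by
  have hcoeff {j : ℕ} (hj : j ≤ 2) : DifferentiableAt ℝ (fun s => P.topSymbol j s ξ) t :=
    (h.hasDerivAt_topSymbol hj ht ξ).differentiableAt
  have h0 := hcoeff zero_le_two
  have h1 := hcoeff one_le_two
  have h2 := hcoeff le_rfl
  simp only [Cubic.discr, topCubic]
  fun_prop

theorem continuousOn_topSymbol (h : P.RegularCoeffs T) {j : ℕ} (hj : j ≤ 2) :
    ContinuousOn (fun p : ℝ × EuclideanSpace ℝ (Fin n) => P.topSymbol j p.1 p.2)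
      (Icc 0 T ×ˢ univ) :=
  continuousOn_monomialSum fun _ hα => (h.analyticOnNhd_top_of_mem hj hα).continuousOn

theorem continuousOn_topSymbolDeriv (h : P.RegularCoeffs T) {j : ℕ} (hj : j ≤ 2) :
    ContinuousOn (fun p : ℝ × EuclideanSpace ℝ (Fin n) => P.topSymbolDeriv j p.1 p.2)
      (Icc 0 T ×ˢ univ) :=
  continuousOn_monomialSum fun _ hα => (h.analyticOnNhd_top_of_mem hj hα).deriv.continuousOn

theorem continuousOn_lowSymbol (h : P.RegularCoeffs T) {j : ℕ} (hj : j ≤ 2) :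
    ContinuousOn (fun p : ℝ × EuclideanSpace ℝ (Fin n) => P.lowSymbol j p.1 p.2)
      (Icc 0 T ×ˢ univ) :=
  continuousOn_monomialSum fun _ hα => h.continuousOn_low_of_mem hj hα

theorem hasPolynomialGrowth_topSymbol (h : P.RegularCoeffs T) {j : ℕ} (hj : j ≤ 2) :
    HasPolynomialGrowth (Icc 0 T) (P.topSymbol j) :=
  hasPolynomialGrowth_monomialSum isCompact_Icc
    fun _ hα => (h.analyticOnNhd_top_of_mem hj hα).continuousOn

theorem hasPolynomialGrowth_topSymbolDeriv (h : P.RegularCoeffs T) {j : ℕ} (hj : j ≤ 2) :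
    HasPolynomialGrowth (Icc 0 T) (P.topSymbolDeriv j) :=
  hasPolynomialGrowth_monomialSum isCompact_Icc
    fun _ hα => (h.analyticOnNhd_top_of_mem hj hα).deriv.continuousOn

theorem hasPolynomialGrowth_lowSymbol (h : P.RegularCoeffs T) {j : ℕ} (hj : j ≤ 2) :
    HasPolynomialGrowth (Icc 0 T) (P.lowSymbol j) :=
  hasPolynomialGrowth_monomialSum isCompact_Icc
    fun _ hα => h.continuousOn_low_of_mem hj hα

theorem continuousOn_eval_mCheckPoly (h : P.RegularCoeffs T)
    {x : ℝ × EuclideanSpace ℝ (Fin n) → ℂ}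
    (hx : ContinuousOn x (Icc 0 T ×ˢ univ)) :
    ContinuousOn (fun p => (P.mCheckPoly p.1 p.2).eval (x p)) (Icc 0 T ×ˢ univ) := by
  have htop {j : ℕ} (hj : j ≤ 2) := h.continuousOn_topSymbolDeriv hj
  have hlow {j : ℕ} (hj : j ≤ 2) := h.continuousOn_lowSymbol hj
  have h1 := Complex.continuous_ofReal.comp_continuousOn (htop one_le_two)
  have h2 := Complex.continuous_ofReal.comp_continuousOn (htop le_rfl)
  simp only [eval_mCheckPoly_eq, Complex.ofReal_mul]
  exact (((hlow le_rfl).mul (hx.pow 2)).add (((hlow one_le_two).sub h2).mul hx)).add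
    ((hlow zero_le_two).sub (continuousOn_const.mul h1))

theorem hasPolynomialGrowth_eval_mCheckPoly (h : P.RegularCoeffs T)
    {x : ℝ → EuclideanSpace ℝ (Fin n) → ℂ} (hx : HasPolynomialGrowth (Icc 0 T) x) :
    HasPolynomialGrowth (Icc 0 T) fun t ξ => (P.mCheckPoly t ξ).eval (x t ξ) := by
  have htop {j : ℕ} (hj : j ≤ 2) (a : ℝ) : HasPolynomialGrowth (Icc 0 T)
      fun t ξ => -((a * P.topSymbolDeriv j t ξ : ℝ) : ℂ) :=
    (HasPolynomialGrowth.smul (.const a) (h.hasPolynomialGrowth_topSymbolDeriv hj)).mono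
      fun t _ ξ => by rw [norm_neg, Complex.norm_real, smul_eq_mul]
  have hlow {j : ℕ} (hj : j ≤ 2) := h.hasPolynomialGrowth_lowSymbol hj
  have hsum := (((hlow le_rfl).smul (hx.smul hx)).add
    (((hlow one_le_two).add (htop le_rfl 1)).smul hx)).add
      ((hlow zero_le_two).add (htop one_le_two (1 / 2)))
  simpa only [eval_mCheckPoly_eq, smul_eq_mul, one_mul, sub_eq_add_neg, sq] using hsum

theorem hasDerivWithinAt_sqrt_discrL (h : P.RegularCoeffs T) (hh : P.WeaklyHyperbolic T)
    {t : ℝ} (ht : t ∈ Icc 0 T) {ξ : EuclideanSpace ℝ (Fin n)}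
    (hD : (P.topCubic t ξ).discr ≠ 0) :
    HasDerivWithinAt (fun s => √(P.discrL s ξ))
      (deriv (fun s => (P.topCubic s ξ).discr) t / (2 * √(P.topCubic t ξ).discr)) (Icc 0 T) t :=
  ((h.differentiableAt_discr_topCubic ht ξ).hasDerivAt.sqrt hD).hasDerivWithinAt.congr
    (fun s hs => by rw [hh.discrL_eq hs]) (by rw [hh.discrL_eq ht])

end RegularCoeffs

namespace WeaklyHyperbolic

theorem sqrt_discr_topCubic (hh : P.WeaklyHyperbolic T) {t : ℝ} (ht : t ∈ Icc 0 T)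
    (ξ : EuclideanSpace ℝ (Fin n)) :
    √(P.topCubic t ξ).discr = |P.tau 0 t ξ - P.tau 1 t ξ| * |P.tau 1 t ξ - P.tau 2 t ξ| *
      |P.tau 2 t ξ - P.tau 0 t ξ| := by
  rw [← hh.discrL_eq ht, discrL, ← mul_pow, ← mul_pow, Real.sqrt_sq_eq_abs, abs_mul, abs_mul]

theorem injective_tau (hh : P.WeaklyHyperbolic T) {t : ℝ} (ht : t ∈ Icc 0 T)
    {ξ : EuclideanSpace ℝ (Fin n)} (hD : (P.topCubic t ξ).discr ≠ 0) :
    Function.Injective (P.tau · t ξ) := by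
  rw [← hh.discrL_eq ht, discrL] at hD
  simp only [ne_eq, mul_eq_zero, pow_eq_zero_iff two_ne_zero, sub_eq_zero, not_or] at hD
  obtain ⟨⟨h01, h12⟩, h20⟩ := hD
  intro i j hij
  fin_cases i <;> fin_cases j <;> first | rfl | exact absurd hij ‹_› | exact absurd hij.symm ‹_›

theorem discr_mul_lagrangeSum_tau_le (hh : P.WeaklyHyperbolic T) {t D' B : ℝ} (ht : t ∈ Icc 0 T)
    {ξ : EuclideanSpace ℝ (Fin n)} (hD : (P.topCubic t ξ).discr ≠ 0) {N : ℂ[X]} (hB : 0 ≤ B)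
    (hN : ∀ q ∈ cyclicTriples, |P.tau q.2.1 t ξ - P.tau q.2.2 t ξ| * ‖N.eval (P.tau q.1 t ξ : ℂ)‖ ≤
      B * (√(P.topCubic t ξ).discr + |D' / (2 * √(P.topCubic t ξ).discr)|)) :
    (lagrangeSum N fun j => (P.tau j t ξ : ℂ)) * (P.topCubic t ξ).discr ≤
      3 * B * ((P.topCubic t ξ).discr + |D'|) := by
  have hnonneg := discr_nonneg_of_splits one_ne_zero (hh.splits_topCubic ht ξ)
  have hpos : 0 < √(P.topCubic t ξ).discr := Real.sqrt_pos.2 (hnonneg.lt_of_ne' hD)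
  have hsq := Real.mul_self_sqrt hnonneg
  have hsum := norm_mul_lagrangeSum_le (N := N) (x := fun j => (P.tau j t ξ : ℂ)) <| by
    simpa only [← Complex.ofReal_sub, Complex.norm_real, Real.norm_eq_abs] using hN
  simp only [← Complex.ofReal_sub, Complex.norm_real, Real.norm_eq_abs,
    ← hh.sqrt_discr_topCubic ht] at hsum
  generalize √(P.topCubic t ξ).discr = s at *
  calc _ = s * (s * lagrangeSum N fun j => (P.tau j t ξ : ℂ)) := by rw [← hsq]; ring
    _ ≤ s * (3 * (B * (s + |D' / (2 * s)|))) := mul_le_mul_of_nonneg_left hsum hpos.le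
    _ = 3 * B * (s * s + |D'| / 2) := by
      rw [abs_div, abs_of_pos (by positivity : 0 < 2 * s)]
      field_simp
    _ ≤ _ := by
      rw [← hsq]
      gcongr
      exact half_le_self (abs_nonneg D')

theorem lagrangeSum_lam_le (hh : P.WeaklyHyperbolic T) {t : ℝ} (ht : t ∈ Icc 0 T)
    {ξ : EuclideanSpace ℝ (Fin n)} (hD : (P.topCubic t ξ).discr ≠ 0)
    {N : ℂ[X]} (hN : N.degree < 3) :
    (lagrangeSum N fun j => (P.lam j t ξ : ℂ)) ≤
      48 * lagrangeSum N fun j => (P.tau j t ξ : ℂ) := by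
  have hpair := hh.isNuijPair ht ξ
  have hconst : ((Fintype.card (Fin 3) : ℕ) : ℝ) * (1 + 3) ^ (Fintype.card (Fin 3) - 1) = 48 := by
    norm_num
  rw [← hconst]
  exact lagrangeSum_le_of_norm_sub_le (N := N) (A := 3)
    (τ := fun j => (P.tau j t ξ : ℂ)) (x := fun j => (P.lam j t ξ : ℂ)) (by simpa using hN)
    (Complex.ofReal_injective.comp (hh.injective_tau ht hD))
    (fun i j hij => by
      simpa only [← Complex.ofReal_sub, Complex.norm_real, Real.norm_eq_abs] using
        hpair.one_le_abs_sub hij)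
    (fun j => by
      simpa only [← Complex.ofReal_sub, Complex.norm_real, Real.norm_eq_abs] using
        hpair.abs_sub_le j)

theorem continuousOn_lam (hh : P.WeaklyHyperbolic T) (h : P.RegularCoeffs T) :
    ContinuousOn (fun (p : ℝ × EuclideanSpace ℝ (Fin n)) j => P.lam j p.1 p.2)
      (Icc 0 T ×ˢ univ) := by
  refine continuousOn_of_strictMono_of_continuousOn_prod_sub
    (fun p hp => (hh.isNuijPair hp.1 p.2).strictMono_right) fun u => ?_
  have htop {j : ℕ} (hj : j ≤ 2) := h.continuousOn_topSymbol hj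
  have h0 := htop zero_le_two
  have h1 := htop one_le_two
  have h2 := htop le_rfl
  have hcont : ContinuousOn (fun p : ℝ × EuclideanSpace ℝ (Fin n) =>
      (nuijCubic (P.topCubic p.1 p.2)).toPoly.eval u) (Icc 0 T ×ˢ univ) := by
    simp only [nuijCubic, topCubic, Cubic.toPoly, eval_add, eval_mul, eval_C, eval_pow, eval_X]
    fun_prop
  refine hcont.congr fun p hp => ?_
  dsimp only
  rw [eval_toPoly_eq_prod_orderedRoot (P := nuijCubic _) one_ne_zero
    (splits_nuijCubic one_ne_zero (hh.splits_topCubic hp.1 p.2)), ← calL_eq_toPoly]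
  exact (one_mul _).symm

theorem hasPolynomialGrowth_tau (hh : P.WeaklyHyperbolic T) (h : P.RegularCoeffs T) (j : Fin 3) :
    HasPolynomialGrowth (Icc 0 T) (P.tau j) := by
  have htop {i : ℕ} (hi : i ≤ 2) := (h.hasPolynomialGrowth_topSymbol hi).norm
  refine ((((HasPolynomialGrowth.const (1 : ℝ)).add (htop le_rfl)).add (htop one_le_two)).add
    (htop zero_le_two)).mono fun t ht ξ => ?_
  refine le_trans ?_ (le_abs_self _)
  have hzero := eval_toPoly_eq_prod_orderedRoot one_ne_zero (hh.splits_topCubic ht ξ) (P.tau j t ξ)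
  rw [← L_eq_toPoly, Finset.prod_eq_zero (Finset.mem_univ j) (sub_self _), mul_zero, L_eq_toPoly]
    at hzero
  simp only [topCubic, Cubic.toPoly, eval_add, eval_mul, eval_C, eval_pow, eval_X, one_mul]
    at hzero
  exact norm_le_of_cubic_eq_zero hzero

theorem hasPolynomialGrowth_lam (hh : P.WeaklyHyperbolic T) (h : P.RegularCoeffs T) (j : Fin 3) :
    HasPolynomialGrowth (Icc 0 T) (P.lam j) := by
  refine ((HasPolynomialGrowth.const (3 : ℝ)).add (hh.hasPolynomialGrowth_tau h j).norm).mono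
    fun t ht ξ => le_trans ?_ (le_abs_self _)
  rw [← sub_le_iff_le_add]
  exact (norm_sub_norm_le _ _).trans ((hh.isNuijPair ht ξ).abs_sub_le j)

theorem continuousOn_leviIntegrand (hh : P.WeaklyHyperbolic T) (h : P.RegularCoeffs T) :
    ContinuousOn (fun p : ℝ × EuclideanSpace ℝ (Fin n) => P.leviIntegrand p.2 p.1)
      (Icc 0 T ×ˢ univ) := by
  have hlam (j : Fin 3) : ContinuousOn
      (fun p : ℝ × EuclideanSpace ℝ (Fin n) => (P.lam j p.1 p.2 : ℂ)) (Icc 0 T ×ˢ univ) :=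
    Complex.continuous_ofReal.comp_continuousOn (continuousOn_pi.1 (hh.continuousOn_lam h) j)
  exact (continuousOn_lagrangeSum (continuousOn_pi.2 hlam)
    (fun p hp => Complex.ofReal_injective.comp
      (hh.isNuijPair hp.1 p.2).strictMono_right.injective)
    fun j => h.continuousOn_eval_mCheckPoly (hlam j)).congr
      fun p hp => leviIntegrand_eq_lagrangeSum h hp.1 p.2

theorem hasPolynomialGrowth_leviIntegrand (hh : P.WeaklyHyperbolic T) (h : P.RegularCoeffs T) :
    HasPolynomialGrowth (Icc 0 T) fun t ξ => P.leviIntegrand ξ t := by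
  have hlam (j : Fin 3) : HasPolynomialGrowth (Icc 0 T) fun t ξ => (P.lam j t ξ : ℂ) :=
    (hh.hasPolynomialGrowth_lam h j).mono fun t _ ξ => (Complex.norm_real _).le
  refine (HasPolynomialGrowth.sum Finset.univ fun j _ =>
    (h.hasPolynomialGrowth_eval_mCheckPoly (hlam j)).norm).mono fun t ht ξ => ?_
  rw [leviIntegrand_eq_lagrangeSum h ht, Real.norm_of_nonneg (lagrangeSum_nonneg _ _)]
  refine le_trans (Finset.sum_le_sum fun j _ => div_le_self (norm_nonneg _) ?_) (le_abs_self _)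
  refine Finset.one_le_prod fun i hi => ?_
  rw [← Complex.ofReal_sub, Complex.norm_real]
  exact (hh.isNuijPair ht ξ).one_le_abs_sub (Finset.ne_of_mem_erase hi).symm

end WeaklyHyperbolic

theorem exists_forall_leviIntegrand_mul_discr_le (hT : 0 < T) (h : P.RegularCoeffs T)
    (hh : P.WeaklyHyperbolic T) (hb : P.PointwiseBound T) :
    ∃ K : ℝ, 0 < K ∧ ∀ t ∈ Icc 0 T, ∀ ξ, P.leviIntegrand ξ t * (P.topCubic t ξ).discr ≤
      K * ((P.topCubic t ξ).discr + |deriv (fun s => (P.topCubic s ξ).discr) t|) := by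
  obtain ⟨K, hK, hb⟩ := hb
  refine ⟨144 * K, by positivity, fun t ht ξ => ?_⟩
  rcases eq_or_ne (P.topCubic t ξ).discr 0 with hD | hD
  · rw [hD, mul_zero, zero_add]
    positivity
  have hderiv := h.hasDerivWithinAt_sqrt_discrL hh ht hD
  have htau := hh.discr_mul_lagrangeSum_tau_le ht hD hK.le (N := P.mCheckPoly t ξ) fun q hq => by
    have hbq := hb q hq t ht ξ hderiv.differentiableWithinAt
    rwa [hderiv.derivWithin (uniqueDiffOn_Icc hT t ht), hh.discrL_eq ht,
      ← h.eval_mCheckPoly ht] at hbq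
  have hlam := hh.lagrangeSum_lam_le ht hD (P.degree_mCheckPoly_lt t ξ)
  have hnonneg := discr_nonneg_of_splits one_ne_zero (hh.splits_topCubic ht ξ)
  rw [leviIntegrand_eq_lagrangeSum h ht]
  linarith [mul_le_mul_of_nonneg_right hlam hnonneg]

end ThirdOrderOperator

end Levi

theorem mainTheorem8_general (n : ℕ) (T : ℝ) (hT : 0 < T) (P : ThirdOrderOperator n)
    (hreg : P.RegularCoeffs T)
    (hhyp : P.WeaklyHyperbolic T)
    (hdisc : ∃ t ∈ Set.Icc 0 T, ∃ ξ : EuclideanSpace ℝ (Fin n), P.discrL t ξ ≠ 0)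
    (hbound : P.PointwiseBound T) :
    P.LeviCondition T := by
  refine ⟨fun t ht ξ _ => ⟨hhyp.splits_calL ht ξ, hhyp.nodup_roots_calL ht ξ⟩, fun r hr => ?_⟩
  obtain ⟨t₀, ht₀, ξ₀, hne⟩ := hdisc
  rw [hhyp.discrL_eq ht₀] at hne
  have hcont := hhyp.continuousOn_leviIntegrand hreg
  obtain ⟨K, hK, hpointwise⟩ :=
    ThirdOrderOperator.exists_forall_leviIntegrand_mul_discr_le hT hreg hhyp hbound
  obtain ⟨C, hC, hlog⟩ := exists_forall_intervalIntegral_le_log hT.le hK hr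
    (fun t ξ => P.leviIntegrand_nonneg ξ t) hcont (hhyp.hasPolynomialGrowth_leviIntegrand hreg)
    hreg.isSeparableAnalytic_discr_topCubic
    (fun t ht ξ => discr_nonneg_of_splits one_ne_zero (hhyp.splits_topCubic ht ξ)) ht₀
    (ThirdOrderOperator.dense_discr_topCubic_ne_zero hne) hpointwise
  refine ⟨C + 1, by positivity, fun ξ hξ => ⟨?_, (hlog ξ hξ).trans ?_⟩⟩
  · exact ContinuousOn.intervalIntegrable_of_Icc hT.le
      (hcont.uncurry_right (f := fun t ξ => P.leviIntegrand ξ t) ξ (mem_univ ξ))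
  · exact mul_le_mul_of_nonneg_right (lt_add_one C).le
      (Real.log_nonneg (le_add_of_nonneg_right (norm_nonneg ξ)))

theorem mainTheorem8 (n : ℕ) (T : ℝ) (hT : 0 < T) (P : ThirdOrderOperator n)
    (hana : P.AnalyticCoeffs T)
    (hhyp : P.WeaklyHyperbolic T)
    (hdisc : ∃ t ∈ Set.Icc 0 T, ∃ ξ : EuclideanSpace ℝ (Fin n), P.discrL t ξ ≠ 0)
    (hbound : P.PointwiseBound T) :
    P.LeviCondition T :=
  mainTheorem8_general n T hT P hana.regularCoeffs hhyp hdisc hbound
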